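/- Let $n\ge 1$, $A_1,\dots,A_n\in\mathbb R^d$, $A=[A_1,\dots,A_n]$, $\lambda,\gamma>0$, and $\|A_i\|_2\le R$ for all $i$. Let $\phi_1,\dots,\phi_n:\mathbb R\to\mathbb R$ be convex and $1/\gamma$-smooth (differentiable with $1/\gamma$-Lipschitz derivative), and let $g:\mathbb R^d\to(-\infty,+\infty]$ be proper, lower semicontinuous and $1$-strongly convex (for instance any finite $1$-strongly convex function). Write $h^*$ for the convex conjugate of $h$. The dual of the regularized ERM problem $\min_w \frac1n\sum_i\phi_i(A_i^Tw)+\lambda g(w)$ is $$\max_{x\in\mathbb R^n}\ D(x)=\frac1n\sum_{i=1}^n-\phi_i^*(-x_i)-\lambda g^*\Bigl(\frac1{\lambda n}Ax\Bigr).$$ Split $-D(x)=f(x)+\sum_i\Psi_i(x_i)$ with $$f(x)=\lambda g^*\Bigl(\frac1{\lambda n}Ax\Bigr)+\frac{\gamma}{2n}\|x\|_2^2,\qquad \Psi_i(t)=\frac1n\Bigl(\phi_i^*(-t)-\frac\gamma2t^2\Bigr),$$ and put $L_i=\frac{\|A_i\|_2^2}{\lambda n^2}+\frac\gamma n$, $\|x\|_L^2=\sum_iL_ix_i^2$.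 The accelerated randomized proximal coordinate gradient (APCG) method, with convexity parameter $\mu$, initial parameter $\gamma_0$ and starting point $x^{(0)}=z^{(0)}$ with $D(x^{(0)})>-\infty$, iterates for $k=0,1,2,\dots$: take $\alpha_k\in(0,\frac1n]$ with $n^2\alpha_k^2=(1-\alpha_k)\gamma_k+\alpha_k\mu$; set $\gamma_{k+1}=(1-\alpha_k)\gamma_k+\alpha_k\mu$, $\beta_k=\alpha_k\mu/\gamma_{k+1}$ and $y^{(k)}=\frac{\alpha_k\gamma_kz^{(k)}+\gamma_{k+1}x^{(k)}}{\alpha_k\gamma_k+\gamma_{k+1}}$; choose $i_k\in\{1,\dots,n\}$ uniformly at random, independently of the past; set $$z^{(k+1)}=\operatorname*{argmin}_{u\in\mathbb R^n}\Bigl\{\frac{n\alpha_k}2\|u-(1-\beta_k)z^{(k)}-\beta_ky^{(k)}\|_L^2+\nabla_{i_k}f(y^{(k)})\,u_{i_k}+\Psi_{i_k}(u_{i_k})\Bigr\},$$ $$x^{(k+1)}=y^{(k)}+n\alpha_k(z^{(k+1)}-z^{(k)})+\frac\mu n(z^{(k)}-y^{(k)}).$$ The parameters are any $\mu\le\gamma_0$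 with $$\mu\ \ge\ \frac{\lambda\gamma n}{R^2+\lambda\gamma n},\qquad \gamma_0L_i\le\frac\gamma n\quad(i=1,\dots,n);$$ for example $\gamma_0=\mu=\frac{\lambda\gamma n}{R^2+\lambda\gamma n}$ or $\gamma_0=\mu=\frac{\gamma}{n\max_iL_i}$. Then the dual problem has a unique solution $x^\star$, its optimal value $D^\star=D(x^\star)$ is finite, the method is well defined, and, with $$C=D^\star-D(x^{(0)})+\frac{\gamma}{2n}\|x^{(0)}-x^\star\|_2^2,$$ for every $\epsilon>0$ and every integer $k\ge 0$ with $$k\ \ge\ \Bigl(n+\sqrt{\frac{nR^2}{\lambda\gamma}}\Bigr)\log(C/\epsilon)$$ one has $\mathbb E\bigl[D^\star-D(x^{(k)})\bigr]\le\epsilon$, where $D(x^{(k)})$ is always finite and the expectation is that of an integrable random variable. (If $C=0$, the condition on $k$ is read as satisfied by every $k\ge0$.) -/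

import Mathlib

open MeasureTheory ProbabilityTheory

noncomputable section

namespace APCG

/-- The Euclidean space `ℝᵐ`. -/
abbrev Vec (m : ℕ) : Type := EuclideanSpace ℝ (Fin m)

/-- Convex conjugate `h*(u) = sup_z (⟨u, z⟩ - h z)` of an extended-real-valued function. -/
def conj {E : Type*} [NormedAddCommGroup E] [InnerProductSpace ℝ E]
    (h : E → EReal) (u : E) : EReal :=
  ⨆ z : E, (((inner ℝ u z : ℝ) : EReal) - h z)

/-- Effective domain of an extended-real-valued function. -/
def effDom {E : Type*} (h : E → EReal) : Set E := {w | h w ≠ ⊤}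

/-- `h` is proper, lower semicontinuous and `m`-strongly convex
(for the Euclidean norm), as a function with values in `(-∞, +∞]`. -/
structure IsClosedStronglyConvex {E : Type*} [NormedAddCommGroup E] [InnerProductSpace ℝ E]
    (m : ℝ) (h : E → EReal) : Prop where
  ne_bot : ∀ w, h w ≠ ⊥
  nonempty_dom : (effDom h).Nonempty
  lsc : LowerSemicontinuous h
  strong : StrongConvexOn (effDom h) m (fun w => (h w).toReal)

/-- `φ : ℝ → ℝ` is `ℓ`-smooth: it is differentiable and its derivative is `ℓ`-Lipschitz. -/
structure IsSmooth (ℓ : ℝ) (φ : ℝ → ℝ) : Prop where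
  differentiable : Differentiable ℝ φ
  lipschitz : ∀ s t, |deriv φ s - deriv φ t| ≤ ℓ * |s - t|

/-- The conjugate of a real-valued function on the line. -/
def conjReal (φ : ℝ → ℝ) (u : ℝ) : EReal := conj (fun z : ℝ => ((φ z : ℝ) : EReal)) u

/-- `A x = ∑ i, x_i A_i`, where `A = [A_1, …, A_n]`. -/
def matVec {n d : ℕ} (A : Fin n → Vec d) (x : Vec n) : Vec d := ∑ i, x i • A i

/-- Dual objective of regularized ERM:
`D(x) = (1/n) ∑ i, -φ_i*(-x_i) - lam g*((1/(lam n)) A x)`. -/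
def dualObj {n d : ℕ} (φ : Fin n → ℝ → ℝ) (g : Vec d → EReal) (A : Fin n → Vec d)
    (lam : ℝ) (x : Vec n) : EReal :=
  ((1 / (n : ℝ) : ℝ) : EReal) * (∑ i, -conjReal (φ i) (-(x i)))
    - (lam : EReal) * conj g ((1 / (lam * n) : ℝ) • matVec A x)

/-- Smooth part of the splitting of `-D`:
`f(x) = lam g*((1/(lam n)) A x) + (gam/(2n)) ‖x‖²`
(under the standing assumptions `g*` is real-valued, so `toReal` loses nothing). -/
def smoothPart {n d : ℕ} (g : Vec d → EReal) (A : Fin n → Vec d) (lam gam : ℝ)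
    (x : Vec n) : ℝ :=
  lam * (conj g ((1 / (lam * n) : ℝ) • matVec A x)).toReal + gam / (2 * n) * ‖x‖ ^ 2

/-- Separable part of the splitting of `-D`:
`Ψ_i(t) = (1/n) (φ_i*(-t) - (gam/2) t²)`. -/
def sepPart {n : ℕ} (φ : Fin n → ℝ → ℝ) (gam : ℝ) (i : Fin n) (t : ℝ) : EReal :=
  ((1 / (n : ℝ) : ℝ) : EReal) * (conjReal (φ i) (-t) - ((gam / 2 * t ^ 2 : ℝ) : EReal))

/-- Coordinate-wise Lipschitz constants of the gradient of the smooth part: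
`L_i = ‖A_i‖²/(lam n²) + gam/n`. -/
def coordLip {n d : ℕ} (A : Fin n → Vec d) (lam gam : ℝ) (i : Fin n) : ℝ :=
  ‖A i‖ ^ 2 / (lam * (n : ℝ) ^ 2) + gam / n

/-- The scalar sequences `α_k`, `γ_k` of the APCG method, with convexity parameter `μ` and
initial value `γ_0 = gam0`: `α_k ∈ (0, 1/n]`, `n² α_k² = (1 - α_k) γ_k + α_k μ` and
`γ_{k+1} = (1 - α_k) γ_k + α_k μ`. -/
structure IsParams (n : ℕ) (μ gam0 : ℝ) (α γ : ℕ → ℝ) : Prop where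
  gamma_zero : γ 0 = gam0
  alpha_pos : ∀ k, 0 < α k
  alpha_le : ∀ k, α k ≤ 1 / (n : ℝ)
  alpha_eq : ∀ k, (n : ℝ) ^ 2 * α k ^ 2 = (1 - α k) * γ k + α k * μ
  gamma_succ : ∀ k, γ (k + 1) = (1 - α k) * γ k + α k * μ

/-- Objective of the proximal step on coordinate `i` of the APCG method, at `(y, z)`, with
step parameters `a = α_k` and `b = β_k`:
`(n a / 2) ‖u - (1 - b) z - b y‖_L² + ∇_i f(y) u_i + Ψ_i(u_i)`. -/
def stepObj {n : ℕ} (f : Vec n → ℝ) (Ψ : Fin n → ℝ → EReal) (L : Fin n → ℝ)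
    (a b : ℝ) (y z : Vec n) (i : Fin n) (u : Vec n) : EReal :=
  (((n : ℝ) * a / 2 * (∑ j, L j * (u j - (1 - b) * z j - b * y j) ^ 2)
      + gradient f y i * u i : ℝ) : EReal) + Ψ i (u i)

/-- `x`, `y`, `z` are the sequences generated by the APCG method for minimizing
`f(x) + ∑ i, Ψ_i(x_i)` over `ℝⁿ` from `x0`, when the coordinates chosen are
`idx 0, idx 1, …`; here `β_k = α_k μ / γ_{k+1}`. -/
structure IsRun {n : ℕ} (f : Vec n → ℝ) (Ψ : Fin n → ℝ → EReal) (L : Fin n → ℝ)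
    (μ : ℝ) (α γ : ℕ → ℝ) (x0 : Vec n) (idx : ℕ → Fin n) (x y z : ℕ → Vec n) : Prop where
  x_zero : x 0 = x0
  z_zero : z 0 = x0
  y_eq : ∀ k, y k =
    (1 / (α k * γ k + γ (k + 1))) • ((α k * γ k) • z k + γ (k + 1) • x k)
  z_succ : ∀ k, IsMinOn (stepObj f Ψ L (α k) (α k * μ / γ (k + 1)) (y k) (z k) (idx k))
    Set.univ (z (k + 1))
  x_succ : ∀ k, x (k + 1) =
    y k + ((n : ℝ) * α k) • (z (k + 1) - z k) + (μ / n) • (z k - y k)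

/-- The indices are chosen independently and uniformly at random in `{1, …, n}`. -/
structure IsUniformSampling {n : ℕ} {Ω : Type*} [MeasurableSpace Ω] (P : Measure Ω)
    (idx : ℕ → Ω → Fin n) : Prop where
  measurable : ∀ k, Measurable (idx k)
  indep : iIndepFun idx P
  uniform : ∀ k j, P {ω | idx k ω = j} = ((n : ENNReal))⁻¹

end APCG

end

namespace APCG

/-! ### Lower semicontinuity in the extended reals -/

/-! Conjugation trades smoothness for strong convexity. Each `φ i` is `1/gam`-smooth, so its
conjugate is `gam`-strongly convex. The splitting moves the term `gam/(2n) ‖x‖²` from the separable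
part to the smooth part: the separable part stays convex, and `f` becomes `gam/n`-strongly convex.
Since `g` is 1-strongly convex, `g*` is finite with quadratic upper bounds, which makes `f`
coordinatewise smooth with constants `L i`. The condition `μ * L i ≤ gam / n` then gives `f`
convexity parameter `μ` for the norm weighted by `L`. Strong convexity of `-D` also yields the
unique dual solution (`exists_dual_maximizer`).

The rate comes from the potential `f(x_k) + p_k - F* + (γ_k/2) ‖z_k - x*‖_L²`, whose mean shrinks by
`1 - α_k` at each step (`lyapunov_decrease`). Here `p_k` is an upper bound for the separable part at
`x_k`. It is needed because `x_{k+1}` is an affine combination of `x_k`, `z_k`, `z_{k+1}` in which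
`z_k` has a nonpositive weight, so convexity does not apply directly. But `x_k` is itself a mixture
of `z_k`, with weight `√γ_k`, and another domain point. After substitution all weights are
nonnegative (`weight_nonneg`, `IsMixture.step`), which keeps the iterates in the domain and `p_k` a
valid bound.

The proximal step has a unique solution (`exists_prox_step`), so a run is a deterministic function
of the indices. Expectations at time `k` are averages over the `n^k` words, and the one-step
estimate iterates (`IsUniformSampling.integral_le_prod`). Finally `γ_{k+1} = (n α_k)² ≥ μ` gives
`α_k ≥ √μ / n`, and the lower bound on `μ` turns `(1 - √μ/n)^k` into the stated complexity. -/

theorem lowerSemicontinuous_add {E : Type*} [TopologicalSpace E] {h k : E → EReal}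
    (hh : LowerSemicontinuous h) (hk : LowerSemicontinuous k)
    (hb : ∀ x, h x ≠ ⊥) (kb : ∀ x, k x ≠ ⊥) : LowerSemicontinuous (fun x => h x + k x) :=
  hh.add' hk fun x => EReal.continuousAt_add (Or.inr (kb x)) (Or.inl (hb x))

theorem lowerSemicontinuous_add_coe {E : Type*} [TopologicalSpace E] {h : E → EReal}
    (hh : LowerSemicontinuous h) {c : E → ℝ} (hc : Continuous c) :
    LowerSemicontinuous (fun x => h x + (c x : EReal)) :=
  hh.add' (continuous_coe_real_ereal.comp hc).lowerSemicontinuous fun _ =>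
    EReal.continuousAt_add (Or.inr (EReal.coe_ne_bot _)) (Or.inr (EReal.coe_ne_top _))

theorem sum_ne_bot {ι : Type*} {s : Finset ι} {a : ι → EReal} (ha : ∀ i ∈ s, a i ≠ ⊥) :
    ∑ i ∈ s, a i ≠ ⊥ := by
  classical
  induction s using Finset.induction_on with
  | empty => simp
  | insert i s hi ih =>
    rw [Finset.sum_insert hi, EReal.add_ne_bot_iff]
    exact ⟨ha i (Finset.mem_insert_self _ _),
      ih fun j hj => ha j (Finset.mem_insert_of_mem hj)⟩

theorem sum_eq_bot {ι : Type*} {s : Finset ι} {a : ι → EReal} {i : ι} (hi : i ∈ s)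
    (ha : a i = ⊥) : ∑ i ∈ s, a i = ⊥ := by
  classical
  rw [← Finset.add_sum_erase s a hi, ha, EReal.bot_add]

theorem coe_finset_sum {ι : Type*} (s : Finset ι) (a : ι → ℝ) :
    ((∑ i ∈ s, a i : ℝ) : EReal) = ∑ i ∈ s, (a i : EReal) := by
  classical
  induction s using Finset.induction_on with
  | empty => simp
  | insert i s hi ih => rw [Finset.sum_insert hi, Finset.sum_insert hi, EReal.coe_add, ih]

theorem lowerSemicontinuous_finset_sum {E ι : Type*} [TopologicalSpace E] {s : Finset ι}
    {h : ι → E → EReal} (hh : ∀ i ∈ s, LowerSemicontinuous (h i))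
    (hb : ∀ i ∈ s, ∀ x, h i x ≠ ⊥) : LowerSemicontinuous (fun x => ∑ i ∈ s, h i x) := by
  classical
  induction s using Finset.induction_on with
  | empty => simpa using lowerSemicontinuous_const
  | insert i s hi ih =>
    simp only [Finset.sum_insert hi]
    exact lowerSemicontinuous_add (hh i (Finset.mem_insert_self _ _))
      (ih (fun j hj => hh j (Finset.mem_insert_of_mem hj))
        fun j hj => hb j (Finset.mem_insert_of_mem hj))
      (hb i (Finset.mem_insert_self _ _))
      fun x => sum_ne_bot fun j hj => hb j (Finset.mem_insert_of_mem hj) x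

/-! ### Minimizers of strongly convex functions -/

/-- Strong convexity supplies coercivity: values outside a large ball exceed the value at `x₁`, so a
minimizer over that compact ball is global. Comparing it with points near it on the segment to `w`
gives the quadratic growth. -/
theorem exists_strong_minimizer {E : Type*} [NormedAddCommGroup E] [InnerProductSpace ℝ E]
    [ProperSpace E] {h : E → EReal} {c : E → ℝ} {m : ℝ} (hm : 0 < m) (hbot : ∀ x, h x ≠ ⊥)
    (hne : (effDom h).Nonempty) (hlsc : LowerSemicontinuous h) (hc : Continuous c)
    (hs : StrongConvexOn (effDom h) m (fun x => (h x).toReal + c x)) :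
    ∃ x₀ ∈ effDom h, ∀ w ∈ effDom h,
      (h x₀).toReal + c x₀ + m / 2 * ‖w - x₀‖ ^ 2 ≤ (h w).toReal + c w := by
  obtain ⟨x₁, hx₁⟩ := hne
  set k : E → ℝ := fun x => (h x).toReal + c x with hk
  have hH : ∀ x ∈ effDom h, h x + (c x : EReal) = (k x : EReal) := by
    intro x hx
    rw [hk, EReal.coe_add, EReal.coe_toReal hx (hbot x)]
  have hlscH := lowerSemicontinuous_add_coe hlsc hc
  have key : ∀ ρ : ℝ, 0 ≤ ρ → ∃ p ∈ effDom h, ∀ w ∈ effDom h, ‖w - x₁‖ ≤ ρ → k p ≤ k w := by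
    intro ρ hρ
    obtain ⟨p, -, hpmin⟩ := (hlscH.lowerSemicontinuousOn (Metric.closedBall x₁ ρ)).exists_isMinOn
      ⟨x₁, Metric.mem_closedBall_self hρ⟩ (isCompact_closedBall x₁ ρ)
    have hp : p ∈ effDom h := by
      intro htop
      have h1 := hpmin (Metric.mem_closedBall_self hρ)
      simp only [Set.mem_ofPred_eq, hH x₁ hx₁, htop, EReal.top_add_coe, top_le_iff] at h1
      exact EReal.coe_ne_top _ h1
    refine ⟨p, hp, fun w hw hwρ => ?_⟩
    have h1 := hpmin (show w ∈ Metric.closedBall x₁ ρ by simpa [dist_eq_norm] using hwρ)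
    simp only [Set.mem_ofPred_eq] at h1
    rw [hH p hp, hH w hw] at h1
    exact_mod_cast h1
  obtain ⟨p, hp, hpmin⟩ := key 1 zero_le_one
  have hp1 : k p ≤ k x₁ := hpmin x₁ hx₁ (by simp)
  -- The segment from `x₁` to `w` leaves the unit ball at a point of value at least `k p`. Beyond
  -- this radius, strong convexity along the segment then forces `k w ≥ k x₁`.
  obtain ⟨x₀, hx₀, hmin⟩ := key (1 + 2 * (k x₁ - k p) / m)
    (by have := div_nonneg (mul_nonneg zero_le_two (sub_nonneg.2 hp1)) hm.le; linarith)
  have hglob : ∀ w ∈ effDom h, k x₀ ≤ k w := by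
    intro w hw
    rcases le_or_gt ‖w - x₁‖ (1 + 2 * (k x₁ - k p) / m) with hr | hr
    · exact hmin w hw hr
    · have h0 : k x₀ ≤ k x₁ := hmin x₁ hx₁ (by
        have := div_nonneg (mul_nonneg zero_le_two (sub_nonneg.2 hp1)) hm.le
        simp only [sub_self, norm_zero]; linarith)
      refine h0.trans ?_
      set r := ‖w - x₁‖ with hrdef
      have hr1 : 1 < r := by
        have := div_nonneg (mul_nonneg zero_le_two (sub_nonneg.2 hp1)) hm.le
        linarith
      have hr0 : 0 < r := by linarith
      have hrm : 2 * (k x₁ - k p) < m * (r - 1) := by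
        have : 2 * (k x₁ - k p) / m < r - 1 := by linarith
        rw [div_lt_iff₀ hm] at this
        linarith
      have hinv : r⁻¹ ≤ 1 := inv_le_one_of_one_le₀ hr1.le
      have h2 := hs.2 hx₁ hw (sub_nonneg.2 hinv) (inv_nonneg.2 hr0.le) (by ring)
      have hmem := hs.1 hx₁ hw (sub_nonneg.2 hinv) (inv_nonneg.2 hr0.le) (by ring)
      have h3 := hpmin _ hmem (by
        have : (1 - r⁻¹) • x₁ + r⁻¹ • w - x₁ = r⁻¹ • (w - x₁) := by module
        rw [this, norm_smul, Real.norm_of_nonneg (inv_nonneg.2 hr0.le), ← hrdef,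
          inv_mul_cancel₀ hr0.ne'])
      have h4 := h3.trans h2
      rw [norm_sub_rev x₁ w, ← hrdef] at h4
      simp only [smul_eq_mul] at h4
      have h5 : r * k p ≤ (r - 1) * k x₁ + k w - (r - 1) * (m / 2 * r) := by
        have h6 := mul_le_mul_of_nonneg_left h4 hr0.le
        have h7 : r * ((1 - r⁻¹) * k x₁ + r⁻¹ * k w - (1 - r⁻¹) * r⁻¹ * (m / 2 * r ^ 2))
            = (r - 1) * k x₁ + k w - (r - 1) * (m / 2 * r) := by
          field_simp
        exact h6.trans_eq h7
      nlinarith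
  refine ⟨x₀, hx₀, fun w hw => ?_⟩
  change k x₀ + m / 2 * ‖w - x₀‖ ^ 2 ≤ k w
  have hstep : ∀ t : ℝ, 0 < t → t < 1 → k x₀ + (1 - t) * (m / 2 * ‖w - x₀‖ ^ 2) ≤ k w := by
    intro t ht0 ht1
    have h2 := hs.2 hx₀ hw (sub_nonneg.2 ht1.le) ht0.le (by ring)
    have h3 := hglob _ (hs.1 hx₀ hw (sub_nonneg.2 ht1.le) ht0.le (by ring))
    have h4 := h3.trans h2
    rw [norm_sub_rev x₀ w] at h4
    simp only [smul_eq_mul] at h4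
    have h5 : t * (k x₀ + (1 - t) * (m / 2 * ‖w - x₀‖ ^ 2)) ≤ t * k w := by linarith
    exact le_of_mul_le_mul_left h5 ht0
  set b := m / 2 * ‖w - x₀‖ ^ 2
  by_contra hcon
  push Not at hcon
  have hle := hglob w hw
  have hb : 0 < b := by linarith
  have hd : 0 < k x₀ + b - k w := by linarith
  -- Replaces the limit `t → 0`: this `t` costs only half of the supposed gap.
  have h1 := hstep ((k x₀ + b - k w) / (2 * b)) (by positivity)
    (by rw [div_lt_one (by positivity)]; linarith)
  have h2 : (1 - (k x₀ + b - k w) / (2 * b)) * b = b - (k x₀ + b - k w) / 2 := by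
    field_simp
  rw [h2] at h1
  linarith

/-! ### Conjugates -/

theorem lowerSemicontinuous_conj {E : Type*} [NormedAddCommGroup E] [InnerProductSpace ℝ E]
    {h : E → EReal} (hbot : ∀ z, h z ≠ ⊥) : LowerSemicontinuous (conj h) := by
  refine lowerSemicontinuous_iSup fun z => ?_
  rcases eq_or_ne (h z) ⊤ with ht | ht
  · simp only [ht, EReal.sub_top]
    exact lowerSemicontinuous_const
  · rw [← EReal.coe_toReal ht (hbot z)]
    simp only [← EReal.coe_sub]
    refine (continuous_coe_real_ereal.comp ?_).lowerSemicontinuous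
    fun_prop

theorem conj_eq_of_isStrongMinimizer {E : Type*} [NormedAddCommGroup E] [InnerProductSpace ℝ E]
    {g : E → EReal} {v w₀ : E} (hbot : ∀ w, g w ≠ ⊥) (hw₀ : w₀ ∈ effDom g)
    (hmin : ∀ w ∈ effDom g, inner ℝ v w - (g w).toReal ≤ inner ℝ v w₀ - (g w₀).toReal) :
    conj g v = ((inner ℝ v w₀ - (g w₀).toReal : ℝ) : EReal) := by
  refine le_antisymm (iSup_le fun w => ?_) ?_
  · rcases eq_or_ne (g w) ⊤ with ht | ht
    · simp [ht]
    · rw [← EReal.coe_toReal ht (hbot w), ← EReal.coe_sub]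
      exact_mod_cast hmin w ht
  · rw [EReal.coe_sub, EReal.coe_toReal hw₀ (hbot w₀)]
    exact le_iSup (fun z => ((inner ℝ v z : ℝ) : EReal) - g z) w₀

theorem IsClosedStronglyConvex.exists_conj_eq {E : Type*} [NormedAddCommGroup E]
    [InnerProductSpace ℝ E] [ProperSpace E] {g : E → EReal} (hg : IsClosedStronglyConvex 1 g)
    (v : E) : ∃ w₀ ∈ effDom g, conj g v = ((inner ℝ v w₀ - (g w₀).toReal : ℝ) : EReal) ∧
      ∀ w ∈ effDom g, inner ℝ v w - (g w).toReal + 1 / 2 * ‖w - w₀‖ ^ 2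
        ≤ inner ℝ v w₀ - (g w₀).toReal := by
  obtain ⟨w₀, hw₀, hmin⟩ := exists_strong_minimizer (c := fun w => -inner ℝ v w) one_pos
    hg.ne_bot hg.nonempty_dom hg.lsc (by fun_prop) (by
      refine ⟨hg.strong.1, fun x hx y hy a b ha hb hab => ?_⟩
      have h1 := hg.strong.2 hx hy ha hb hab
      simp only [inner_add_right, inner_smul_right, smul_eq_mul] at h1 ⊢
      linarith)
  have hmin' : ∀ w ∈ effDom g, inner ℝ v w - (g w).toReal + 1 / 2 * ‖w - w₀‖ ^ 2
        ≤ inner ℝ v w₀ - (g w₀).toReal := fun w hw => by linarith [hmin w hw]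
  exact ⟨w₀, hw₀, conj_eq_of_isStrongMinimizer hg.ne_bot hw₀ fun w hw => by
    nlinarith [hmin' w hw, sq_nonneg ‖w - w₀‖], hmin'⟩

theorem IsClosedStronglyConvex.conj_ne_bot {E : Type*} [NormedAddCommGroup E]
    [InnerProductSpace ℝ E] [ProperSpace E] {g : E → EReal} (hg : IsClosedStronglyConvex 1 g)
    (v : E) : conj g v ≠ ⊥ := by
  obtain ⟨w₀, -, h, -⟩ := hg.exists_conj_eq v
  rw [h]
  exact EReal.coe_ne_bot _

theorem IsClosedStronglyConvex.conj_ne_top {E : Type*} [NormedAddCommGroup E]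
    [InnerProductSpace ℝ E] [ProperSpace E] {g : E → EReal} (hg : IsClosedStronglyConvex 1 g)
    (v : E) : conj g v ≠ ⊤ := by
  obtain ⟨w₀, -, h, -⟩ := hg.exists_conj_eq v
  rw [h]
  exact EReal.coe_ne_top _

/-- The conjugate of a strongly convex function lies between its tangent and a parabola. -/
theorem IsClosedStronglyConvex.exists_conj_bounds {E : Type*} [NormedAddCommGroup E]
    [InnerProductSpace ℝ E] [ProperSpace E] {g : E → EReal} (hg : IsClosedStronglyConvex 1 g)
    (v : E) : ∃ w₀ : E, ∀ v' : E,
      (conj g v).toReal + inner ℝ w₀ (v' - v) ≤ (conj g v').toReal ∧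
      (conj g v').toReal ≤ (conj g v).toReal + inner ℝ w₀ (v' - v) + 1 / 2 * ‖v' - v‖ ^ 2 := by
  obtain ⟨w₀, hw₀, h0, hmin⟩ := hg.exists_conj_eq v
  refine ⟨w₀, fun v' => ?_⟩
  obtain ⟨w', hw', h1, hmin'⟩ := hg.exists_conj_eq v'
  rw [h0, h1, EReal.toReal_coe, EReal.toReal_coe]
  constructor
  · have := hmin' w₀ hw₀
    rw [inner_sub_right, real_inner_comm v' w₀, real_inner_comm v w₀]
    nlinarith [sq_nonneg ‖w₀ - w'‖]
  · have h2 := hmin w' hw'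
    -- Completing the square: `⟨v' - v, w' - w₀⟩` is absorbed by the quadratic gap at `w₀` and `½
    -- ‖v' - v‖²`.
    have h3 := sq_nonneg ‖(v' - v) - (w' - w₀)‖
    rw [norm_sub_sq_real, inner_sub_left, inner_sub_right, inner_sub_right] at h3
    rw [inner_sub_right, real_inner_comm v' w₀, real_inner_comm v w₀]
    linarith

theorem conjReal_le_coe {φ : ℝ → ℝ} {u a : ℝ} :
    conjReal φ u ≤ (a : EReal) ↔ ∀ z, u * z - φ z ≤ a := by
  unfold conjReal conj
  rw [iSup_le_iff]
  refine forall_congr' fun z => ?_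
  rw [← EReal.coe_sub, EReal.coe_le_coe_iff, RCLike.inner_apply, RCLike.conj_to_real, mul_comm]

theorem conjReal_ne_bot (φ : ℝ → ℝ) (u : ℝ) : conjReal φ u ≠ ⊥ := by
  refine ne_bot_of_le_ne_bot (EReal.coe_ne_bot (inner ℝ u (0 : ℝ) - φ 0)) ?_
  rw [EReal.coe_sub]
  exact le_iSup (fun z : ℝ => ((inner ℝ u z : ℝ) : EReal) - ((φ z : ℝ) : EReal)) 0

theorem le_toReal_conjReal {φ : ℝ → ℝ} {u : ℝ} (hu : conjReal φ u ≠ ⊤) (z : ℝ) :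
    u * z - φ z ≤ (conjReal φ u).toReal :=
  conjReal_le_coe.1 (EReal.coe_toReal hu (conjReal_ne_bot φ u)).ge z

/-! ### Smooth functions on the line and their conjugates -/

theorem tangent_le_of_convexOn {φ : ℝ → ℝ} (hφ : ConvexOn ℝ Set.univ φ)
    (hd : Differentiable ℝ φ) (z w : ℝ) : φ z + deriv φ z * (w - z) ≤ φ w := by
  rcases lt_trichotomy z w with h | h | h
  · have h1 := hφ.deriv_le_slope (Set.mem_univ z) (Set.mem_univ w) h (hd z)
    rw [slope_def_field, le_div_iff₀ (sub_pos.2 h)] at h1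
    linarith
  · simp [h]
  · have h1 := hφ.slope_le_deriv (Set.mem_univ w) (Set.mem_univ z) h (hd z)
    rw [slope_def_field, div_le_iff₀ (sub_pos.2 h)] at h1
    linarith

/-- The Lipschitz bound makes the derivative of `ℓ/2 s² - φ s` monotone; the bound is the tangent
inequality of this convex function. -/
theorem IsSmooth.le_parabola {ℓ : ℝ} {φ : ℝ → ℝ} (hφ : IsSmooth ℓ φ) (z w : ℝ) :
    φ w ≤ φ z + deriv φ z * (w - z) + ℓ / 2 * (w - z) ^ 2 := by
  have hder : ∀ s, HasDerivAt (fun s => ℓ / 2 * s ^ 2 - φ s) (ℓ * s - deriv φ s) s := by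
    intro s
    have h1 := ((hasDerivAt_pow 2 s).const_mul (ℓ / 2)).sub (hφ.differentiable s).hasDerivAt
    refine h1.congr_deriv ?_
    norm_num
    ring
  have hdiff : Differentiable ℝ (fun s => ℓ / 2 * s ^ 2 - φ s) := fun s =>
    (hder s).differentiableAt
  have hderiv : deriv (fun s => ℓ / 2 * s ^ 2 - φ s) = fun s => ℓ * s - deriv φ s :=
    funext fun s => (hder s).deriv
  have hconv : ConvexOn ℝ Set.univ (fun s => ℓ / 2 * s ^ 2 - φ s) := by
    refine Monotone.convexOn_univ_of_deriv hdiff ?_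
    rw [hderiv]
    intro s t hst
    have h1 := (le_abs_self _).trans (hφ.lipschitz t s)
    rw [abs_of_nonneg (sub_nonneg.2 hst)] at h1
    simp only
    linarith
  have h1 := tangent_le_of_convexOn hconv hdiff z w
  rw [hderiv] at h1
  simp only at h1
  linarith

/-- The suprema at `u₀` and `u₁` are tested at `z` shifted by `gam b (u₀ - u₁)` and `-gam a (u₀ -
u₁)`. The `(a, b)`-average of the shifts is zero, so the derivative terms of the two parabola bounds
cancel and the quadratic gain remains. -/
theorem strongConvexOn_conjReal {gam : ℝ} (hgam : 0 < gam) {φ : ℝ → ℝ}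
    (hφ : IsSmooth (1 / gam) φ) :
    StrongConvexOn (effDom (conjReal φ)) gam (fun u => (conjReal φ u).toReal) := by
  have key : ∀ u₀ ∈ effDom (conjReal φ), ∀ u₁ ∈ effDom (conjReal φ), ∀ a b : ℝ, 0 ≤ a → 0 ≤ b →
      a + b = 1 → conjReal φ (a * u₀ + b * u₁) ≤ ((a * (conjReal φ u₀).toReal
        + b * (conjReal φ u₁).toReal - a * b * (gam / 2 * (u₀ - u₁) ^ 2) : ℝ) : EReal) := by
    intro u₀ h₀ u₁ h₁ a b ha hb hab
    refine conjReal_le_coe.2 fun z => ?_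
    have e₀ := mul_le_mul_of_nonneg_left
      (le_toReal_conjReal h₀ (z + gam * b * (u₀ - u₁))) ha
    have e₁ := mul_le_mul_of_nonneg_left
      (le_toReal_conjReal h₁ (z - gam * a * (u₀ - u₁))) hb
    have q₀ := mul_le_mul_of_nonneg_left (hφ.le_parabola z (z + gam * b * (u₀ - u₁))) ha
    have q₁ := mul_le_mul_of_nonneg_left (hφ.le_parabola z (z - gam * a * (u₀ - u₁))) hb
    have r₀ : 1 / gam / 2 * (z + gam * b * (u₀ - u₁) - z) ^ 2
        = gam / 2 * b ^ 2 * (u₀ - u₁) ^ 2 := by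
      field_simp; ring
    have r₁ : 1 / gam / 2 * (z - gam * a * (u₀ - u₁) - z) ^ 2
        = gam / 2 * a ^ 2 * (u₀ - u₁) ^ 2 := by
      field_simp; ring
    rw [r₀] at q₀
    rw [r₁] at q₁
    obtain rfl : a = 1 - b := by linarith
    nlinarith
  refine ⟨fun u₀ h₀ u₁ h₁ a b ha hb hab => ?_, fun u₀ h₀ u₁ h₁ a b ha hb hab => ?_⟩
  · exact ne_top_of_le_ne_top (EReal.coe_ne_top _) (key u₀ h₀ u₁ h₁ a b ha hb hab)
  · have h1 := EReal.toReal_le_toReal (key u₀ h₀ u₁ h₁ a b ha hb hab)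
      (conjReal_ne_bot _ _) (EReal.coe_ne_top _)
    rw [EReal.toReal_coe] at h1
    simpa [smul_eq_mul, Real.norm_eq_abs, sq_abs] using h1

theorem conjReal_deriv_ne_top {φ : ℝ → ℝ} (hφ : ConvexOn ℝ Set.univ φ)
    (hd : Differentiable ℝ φ) : conjReal φ (deriv φ 0) ≠ ⊤ := by
  refine ne_top_of_le_ne_top (EReal.coe_ne_top (-φ 0)) (conjReal_le_coe.2 fun z => ?_)
  have := tangent_le_of_convexOn hφ hd 0 z
  linarith

theorem lowerSemicontinuous_conjReal (φ : ℝ → ℝ) : LowerSemicontinuous (conjReal φ) :=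
  lowerSemicontinuous_conj fun _ => EReal.coe_ne_bot _

/-! ### The separable part -/

section SepPart

variable {n : ℕ} {φ : Fin n → ℝ → ℝ} {gam : ℝ} {i : Fin n} {t : ℝ}

theorem sepPart_eq_coe (h : conjReal (φ i) (-t) ≠ ⊤) :
    sepPart φ gam i t
      = ((1 / n * ((conjReal (φ i) (-t)).toReal - gam / 2 * t ^ 2) : ℝ) : EReal) := by
  unfold sepPart
  rw [EReal.coe_mul (1 / (n : ℝ)), EReal.coe_sub (conjReal (φ i) (-t)).toReal,
    EReal.coe_toReal h (conjReal_ne_bot _ _)]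

theorem sepPart_eq_top (hn : 0 < n) (h : conjReal (φ i) (-t) = ⊤) : sepPart φ gam i t = ⊤ := by
  unfold sepPart
  rw [h, EReal.top_sub_coe, EReal.coe_mul_top_of_pos (by positivity)]

theorem sepPart_ne_top_iff (hn : 0 < n) : sepPart φ gam i t ≠ ⊤ ↔ conjReal (φ i) (-t) ≠ ⊤ := by
  refine ⟨fun h h' => h (sepPart_eq_top hn h'), fun h => ?_⟩
  rw [sepPart_eq_coe h]
  exact EReal.coe_ne_top _

theorem sepPart_ne_bot (hn : 0 < n) : sepPart φ gam i t ≠ ⊥ := by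
  by_cases h : conjReal (φ i) (-t) = ⊤
  · simp [sepPart_eq_top hn h]
  · rw [sepPart_eq_coe h]
    exact EReal.coe_ne_bot _

theorem toReal_sepPart (h : conjReal (φ i) (-t) ≠ ⊤) :
    (sepPart φ gam i t).toReal = 1 / n * ((conjReal (φ i) (-t)).toReal - gam / 2 * t ^ 2) := by
  rw [sepPart_eq_coe h, EReal.toReal_coe]

theorem lowerSemicontinuous_sepPart : LowerSemicontinuous (sepPart φ gam i) := by
  have h1 : LowerSemicontinuous
      (fun t => conjReal (φ i) (-t) - ((gam / 2 * t ^ 2 : ℝ) : EReal)) := by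
    have h2 : LowerSemicontinuous (fun t : ℝ => conjReal (φ i) (-t)) :=
      (lowerSemicontinuous_conjReal (φ i)).comp continuous_neg
    have := lowerSemicontinuous_add_coe h2 (c := fun t => -(gam / 2 * t ^ 2)) (by fun_prop)
    simpa only [EReal.coe_neg, ← sub_eq_add_neg] using this
  have hmono : Monotone (fun a : EReal => ((1 / (n : ℝ) : ℝ) : EReal) * a) := fun a b hab =>
    mul_le_mul_of_nonneg_left hab (by exact_mod_cast (by positivity : (0 : ℝ) ≤ 1 / n))
  have hcont : Continuous (fun a : EReal => ((1 / (n : ℝ) : ℝ) : EReal) * a) :=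
    continuous_iff_continuousAt.2 fun _ => EReal.Tendsto.const_mul Filter.tendsto_id
      (Or.inl (EReal.coe_ne_bot _)) (Or.inl (EReal.coe_ne_top _))
  exact hcont.comp_lowerSemicontinuous h1 hmono

/-- Subtracting `gam/2 t²` consumes exactly the strong convexity of the conjugate. -/
theorem convexOn_sepPart (hn : 0 < n) (hgam : 0 < gam) (hφ : IsSmooth (1 / gam) (φ i)) :
    ConvexOn ℝ (effDom (sepPart φ gam i)) (fun t => (sepPart φ gam i t).toReal) := by
  have hs := strongConvexOn_conjReal hgam hφ
  have hmem : ∀ t, t ∈ effDom (sepPart φ gam i) ↔ -t ∈ effDom (conjReal (φ i)) := fun t =>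
    sepPart_ne_top_iff hn
  have hcomb : ∀ a b s t : ℝ, -(a • s + b • t) = a • (-s) + b • (-t) := fun a b s t => by
    simp only [smul_eq_mul]; ring
  have hconv : Convex ℝ (effDom (sepPart φ gam i)) := by
    intro s hsm t htm a b ha hb hab
    rw [hmem] at hsm htm ⊢
    rw [hcomb]
    exact hs.1 hsm htm ha hb hab
  refine ⟨hconv, fun s hsm t htm a b ha hb hab => ?_⟩
  have hst := hconv hsm htm ha hb hab
  simp only
  rw [toReal_sepPart ((hmem _).1 hsm), toReal_sepPart ((hmem _).1 htm),
    toReal_sepPart ((hmem _).1 hst), hcomb]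
  have h1 := hs.2 ((hmem _).1 hsm) ((hmem _).1 htm) ha hb hab
  simp only [smul_eq_mul, Real.norm_eq_abs, sq_abs] at h1 ⊢
  have hn' : (0 : ℝ) ≤ 1 / n := by positivity
  have h2 := mul_le_mul_of_nonneg_left h1 hn'
  obtain rfl : a = 1 - b := by linarith
  refine le_trans (le_of_eq ?_) ((sub_le_sub_right h2
    (1 / n * (gam / 2 * ((1 - b) * s + b * t) ^ 2))).trans (le_of_eq ?_)) <;> ring

end SepPart

/-! ### The matrix-vector product -/

section MatVec

variable {n d : ℕ} (A : Fin n → Vec d)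

theorem matVec_sub (x y : Vec n) : matVec A (x - y) = matVec A x - matVec A y := by
  simp [matVec, sub_smul, Finset.sum_sub_distrib]

theorem inner_matVec (w : Vec d) (x : Vec n) :
    inner ℝ w (matVec A x) = ∑ i, inner ℝ w (A i) * x i := by
  simp [matVec, inner_sum, inner_smul_right, mul_comm]

theorem matVec_eq_smul {x : Vec n} {i : Fin n} (hx : ∀ j, j ≠ i → x j = 0) :
    matVec A x = x i • A i := by
  unfold matVec
  exact Finset.sum_eq_single i (fun j _ hj => by rw [hx j hj, zero_smul]) (by simp)

theorem norm_matVec_le (x : Vec n) : ‖matVec A x‖ ≤ (∑ i, ‖A i‖) * ‖x‖ := by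
  unfold matVec
  rw [Finset.sum_mul]
  refine norm_sum_le_of_le _ fun i _ => ?_
  rw [norm_smul, mul_comm]
  exact mul_le_mul_of_nonneg_left (PiLp.norm_apply_le x i) (norm_nonneg _)

end MatVec

theorem norm_sq_eq_sum {n : ℕ} (x : Vec n) : ‖x‖ ^ 2 = ∑ i, x i ^ 2 := by
  rw [EuclideanSpace.norm_sq_eq]
  simp

theorem inner_eq_sum {n : ℕ} (x y : Vec n) : inner ℝ x y = ∑ i, x i * y i := by
  rw [PiLp.inner_apply]
  simp [mul_comm]

/-! ### Functions with strong tangents -/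

/-- The tangent at the mixed point is used towards both ends; the linear terms cancel in the
weighted sum. -/
theorem strongConvexOn_univ_of_tangent {E : Type*} [NormedAddCommGroup E]
    [InnerProductSpace ℝ E] {f : E → ℝ} {m : ℝ} {G : E → E}
    (h : ∀ y w, f y + inner ℝ (G y) (w - y) + m / 2 * ‖w - y‖ ^ 2 ≤ f w) :
    StrongConvexOn Set.univ m f := by
  refine ⟨convex_univ, fun x _ y _ a b ha hb hab => ?_⟩
  obtain rfl : a = 1 - b := by linarith
  have h1 := mul_le_mul_of_nonneg_left (h ((1 - b) • x + b • y) x) ha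
  have h2 := mul_le_mul_of_nonneg_left (h ((1 - b) • x + b • y) y) hb
  have e1 : x - ((1 - b) • x + b • y) = b • (x - y) := by module
  have e2 : y - ((1 - b) • x + b • y) = (-(1 - b)) • (x - y) := by module
  rw [e1, inner_smul_right, norm_smul, mul_pow, Real.norm_eq_abs, sq_abs] at h1
  rw [e2, inner_smul_right, norm_smul, mul_pow, Real.norm_eq_abs, sq_abs] at h2
  simp only [smul_eq_mul]
  linarith

theorem hasGradientAt_of_sq_bounds {E : Type*} [NormedAddCommGroup E] [InnerProductSpace ℝ E]
    [CompleteSpace E] {f : E → ℝ} {y G : E} {K : ℝ}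
    (h : ∀ w, |f w - f y - inner ℝ G (w - y)| ≤ K * ‖w - y‖ ^ 2) : HasGradientAt f G y := by
  rw [hasGradientAt_iff_isLittleO]
  refine Asymptotics.IsBigO.trans_isLittleO (g := fun w => ‖w - y‖ ^ 2) ?_
    (Asymptotics.isLittleO_pow_sub_sub y one_lt_two)
  refine Asymptotics.IsBigO.of_bound K (Filter.Eventually.of_forall fun w => ?_)
  simpa using h w

/-! ### The smooth part -/

section SmoothPart

variable {n d : ℕ} {g : Vec d → EReal} {A : Fin n → Vec d} {lam gam : ℝ}

theorem exists_smoothPart_bounds (hn : 0 < n) (hlam : 0 < lam)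
    (hg : IsClosedStronglyConvex 1 g) (y : Vec n) : ∃ G : Vec n, ∀ w : Vec n,
      smoothPart g A lam gam y + inner ℝ G (w - y) + gam / n / 2 * ‖w - y‖ ^ 2
        ≤ smoothPart g A lam gam w ∧
      smoothPart g A lam gam w ≤ smoothPart g A lam gam y + inner ℝ G (w - y)
        + gam / n / 2 * ‖w - y‖ ^ 2 + 1 / (2 * lam * n ^ 2) * ‖matVec A (w - y)‖ ^ 2 := by
  have hn' : (0 : ℝ) < n := Nat.cast_pos.2 hn
  obtain ⟨w₀, hw₀⟩ := hg.exists_conj_bounds ((1 / (lam * n) : ℝ) • matVec A y)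
  -- Chain rule: `w₀` plays the role of the gradient of `g*` at the scaled image of `y`.
  refine ⟨WithLp.toLp 2 fun i => 1 / n * inner ℝ w₀ (A i) + gam / n * y i, fun w => ?_⟩
  have hG : inner ℝ (WithLp.toLp 2 fun i => 1 / n * inner ℝ w₀ (A i) + gam / n * y i : Vec n)
      (w - y) = 1 / n * inner ℝ w₀ (matVec A (w - y)) + gam / n * inner ℝ y (w - y) := by
    rw [inner_eq_sum, inner_matVec, inner_eq_sum, Finset.mul_sum, Finset.mul_sum,
      ← Finset.sum_add_distrib]
    exact Finset.sum_congr rfl fun i _ => by simp only; ring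
  have hsq : ‖w‖ ^ 2 = ‖y‖ ^ 2 + 2 * inner ℝ y (w - y) + ‖w - y‖ ^ 2 := by
    rw [← norm_add_sq_real, add_sub_cancel]
  obtain ⟨h1, h2⟩ := hw₀ ((1 / (lam * n) : ℝ) • matVec A w)
  rw [← smul_sub, ← matVec_sub, inner_smul_right] at h1 h2
  rw [norm_smul, mul_pow, Real.norm_eq_abs, sq_abs] at h2
  replace h1 := mul_le_mul_of_nonneg_left h1 hlam.le
  replace h2 := mul_le_mul_of_nonneg_left h2 hlam.le
  have e1 : lam * (1 / (lam * n) * inner ℝ w₀ (matVec A (w - y)))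
      = 1 / n * inner ℝ w₀ (matVec A (w - y)) := by field_simp
  have e2 : lam * (1 / 2 * ((1 / (lam * n)) ^ 2 * ‖matVec A (w - y)‖ ^ 2))
      = 1 / (2 * lam * n ^ 2) * ‖matVec A (w - y)‖ ^ 2 := by field_simp
  have e3 : gam / (2 * n) = gam / n / 2 := by field_simp
  unfold smoothPart
  rw [hG, hsq, e3]
  rw [mul_add, e1] at h1
  rw [mul_add, mul_add, e1, e2] at h2
  constructor <;> nlinarith

/-- Differentiability ensures that `gradient` in the algorithm is the true gradient and not its
default value. -/
theorem hasGradientAt_smoothPart (hn : 0 < n) (hlam : 0 < lam) (hgam : 0 < gam)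
    (hg : IsClosedStronglyConvex 1 g) (y : Vec n) :
    HasGradientAt (smoothPart g A lam gam) (gradient (smoothPart g A lam gam) y) y ∧
    ∀ w : Vec n,
      smoothPart g A lam gam y + inner ℝ (gradient (smoothPart g A lam gam) y) (w - y)
        + gam / n / 2 * ‖w - y‖ ^ 2 ≤ smoothPart g A lam gam w ∧
      smoothPart g A lam gam w
        ≤ smoothPart g A lam gam y + inner ℝ (gradient (smoothPart g A lam gam) y) (w - y)
        + gam / n / 2 * ‖w - y‖ ^ 2 + 1 / (2 * lam * n ^ 2) * ‖matVec A (w - y)‖ ^ 2 := by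
  obtain ⟨G, hG⟩ := exists_smoothPart_bounds (A := A) (gam := gam) hn hlam hg y
  have hgrad : HasGradientAt (smoothPart g A lam gam) G y := by
    refine hasGradientAt_of_sq_bounds
      (K := gam / n / 2 + 1 / (2 * lam * n ^ 2) * (∑ i, ‖A i‖) ^ 2) fun w => ?_
    obtain ⟨h1, h2⟩ := hG w
    have h3 : 0 ≤ gam / n / 2 * ‖w - y‖ ^ 2 := by positivity
    have h4 : 1 / (2 * lam * n ^ 2) * ‖matVec A (w - y)‖ ^ 2
        ≤ 1 / (2 * lam * n ^ 2) * ((∑ i, ‖A i‖) * ‖w - y‖) ^ 2 := by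
      have := norm_matVec_le A (w - y)
      gcongr
    rw [abs_of_nonneg (by linarith)]
    linarith
  rw [hgrad.gradient]
  exact ⟨hgrad, hG⟩

theorem continuous_smoothPart (hn : 0 < n) (hlam : 0 < lam) (hgam : 0 < gam)
    (hg : IsClosedStronglyConvex 1 g) : Continuous (smoothPart g A lam gam) :=
  continuous_iff_continuousAt.2 fun y =>
    (hasGradientAt_smoothPart hn hlam hgam hg y).1.continuousAt

theorem smoothPart_le_of_eq_off (hn : 0 < n) (hlam : 0 < lam) (hgam : 0 < gam)
    (hg : IsClosedStronglyConvex 1 g) {y w : Vec n} {i : Fin n} (hw : ∀ j, j ≠ i → w j = y j) :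
    smoothPart g A lam gam w ≤ smoothPart g A lam gam y
      + gradient (smoothPart g A lam gam) y i * (w i - y i)
      + coordLip A lam gam i / 2 * (w i - y i) ^ 2 := by
  have hn' : (0 : ℝ) < n := Nat.cast_pos.2 hn
  have h := ((hasGradientAt_smoothPart (A := A) hn hlam hgam hg y).2 w).2
  have hz : ∀ j, j ≠ i → (w - y) j = 0 := fun j hj => by simp [hw j hj]
  have e1 : inner ℝ (gradient (smoothPart g A lam gam) y) (w - y)
      = gradient (smoothPart g A lam gam) y i * (w i - y i) := by
    rw [inner_eq_sum]
    exact Finset.sum_eq_single i (fun j _ hj => by rw [hz j hj, mul_zero]) (by simp)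
  have e2 : ‖w - y‖ ^ 2 = (w i - y i) ^ 2 := by
    rw [norm_sq_eq_sum]
    exact Finset.sum_eq_single i (fun j _ hj => by rw [hz j hj]; simp) (by simp)
  rw [matVec_eq_smul A hz, norm_smul, mul_pow, Real.norm_eq_abs, sq_abs, e1, e2] at h
  refine h.trans_eq ?_
  unfold coordLip
  simp only [PiLp.sub_apply]
  field_simp
  ring

end SmoothPart

/-! ### The dual objective -/

section Dual

variable {n d : ℕ} {φ : Fin n → ℝ → ℝ} {g : Vec d → EReal} {A : Fin n → Vec d} {lam gam : ℝ}

theorem dualObj_eq_coe (hn : 0 < n) (hg : IsClosedStronglyConvex 1 g) {x : Vec n}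
    (hx : ∀ i, x i ∈ effDom (sepPart φ gam i)) :
    dualObj φ g A lam x
      = ((-(smoothPart g A lam gam x + ∑ i, (sepPart φ gam i (x i)).toReal) : ℝ) : EReal) := by
  have hx' : ∀ i, conjReal (φ i) (-(x i)) ≠ ⊤ := fun i => (sepPart_ne_top_iff hn).1 (hx i)
  have h1 : ∑ i, -conjReal (φ i) (-(x i))
      = ((∑ i, -(conjReal (φ i) (-(x i))).toReal : ℝ) : EReal) := by
    rw [coe_finset_sum]
    refine Finset.sum_congr rfl fun i _ => ?_
    rw [EReal.coe_neg, EReal.coe_toReal (hx' i) (conjReal_ne_bot _ _)]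
  unfold dualObj
  rw [h1, ← EReal.coe_toReal (hg.conj_ne_top _) (hg.conj_ne_bot _), ← EReal.coe_mul,
    ← EReal.coe_mul, ← EReal.coe_sub]
  congr 1
  unfold smoothPart
  rw [Finset.sum_congr rfl fun i _ => toReal_sepPart (gam := gam) (hx' i), norm_sq_eq_sum,
    ← Finset.mul_sum, Finset.sum_sub_distrib, Finset.sum_neg_distrib, ← Finset.mul_sum]
  have hn' : (n : ℝ) ≠ 0 := Nat.cast_ne_zero.2 hn.ne'
  field_simp
  ring

theorem dualObj_eq_bot (hn : 0 < n) {x : Vec n} {i : Fin n}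
    (hx : x i ∉ effDom (sepPart φ gam i)) : dualObj φ g A lam x = ⊥ := by
  have hx' : conjReal (φ i) (-(x i)) = ⊤ := by
    by_contra h
    exact hx ((sepPart_ne_top_iff hn).2 h)
  unfold dualObj
  rw [sum_eq_bot (Finset.mem_univ i) (by rw [hx', EReal.neg_top]),
    EReal.coe_mul_bot_of_pos (by positivity), EReal.bot_sub]

theorem dualObj_ne_bot_iff (hn : 0 < n) (hg : IsClosedStronglyConvex 1 g) {x : Vec n} :
    dualObj φ g A lam x ≠ ⊥ ↔ ∀ i, x i ∈ effDom (sepPart φ gam i) := by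
  refine ⟨fun h i => ?_, fun h => ?_⟩
  · by_contra hi
    exact h (dualObj_eq_bot hn hi)
  · rw [dualObj_eq_coe hn hg h]
    exact EReal.coe_ne_bot _

/-- The sum of the `gam/n`-strongly convex smooth part and the convex separable part has a minimizer
with quadratic growth, which gives uniqueness. The domain is nonempty because the conjugate of `φ i`
is finite at `deriv (φ i) 0`. -/
theorem exists_dual_maximizer (hn : 0 < n) (hlam : 0 < lam) (hgam : 0 < gam)
    (hφconv : ∀ i, ConvexOn ℝ Set.univ (φ i)) (hφ : ∀ i, IsSmooth (1 / gam) (φ i))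
    (hg : IsClosedStronglyConvex 1 g) :
    ∃ xs : Vec n, (∀ i, xs i ∈ effDom (sepPart φ gam i)) ∧
      ∀ x : Vec n, (∀ i, x i ∈ effDom (sepPart φ gam i)) →
        smoothPart g A lam gam xs + ∑ i, (sepPart φ gam i (xs i)).toReal
          + gam / n / 2 * ‖x - xs‖ ^ 2
        ≤ smoothPart g A lam gam x + ∑ i, (sepPart φ gam i (x i)).toReal := by
  have hbot : ∀ i t, sepPart φ gam i t ≠ ⊥ := fun i t => sepPart_ne_bot hn
  have hmem : ∀ x : Vec n, x ∈ effDom (fun x : Vec n => ∑ i, sepPart φ gam i (x i)) ↔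
      ∀ i, x i ∈ effDom (sepPart φ gam i) := by
    intro x
    refine ⟨fun h i hi => h ?_, fun h => ?_⟩
    · change ∑ i, sepPart φ gam i (x i) = ⊤
      rw [← Finset.add_sum_erase _ _ (Finset.mem_univ i), hi]
      exact EReal.top_add_of_ne_bot (sum_ne_bot fun j _ => hbot j _)
    · change ∑ i, sepPart φ gam i (x i) ≠ ⊤
      rw [Finset.sum_congr rfl fun i _ => (EReal.coe_toReal (h i) (hbot i _)).symm,
        ← coe_finset_sum]
      exact EReal.coe_ne_top _
  have hreal : ∀ x : Vec n, (∀ i, x i ∈ effDom (sepPart φ gam i)) →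
      (∑ i, sepPart φ gam i (x i)).toReal = ∑ i, (sepPart φ gam i (x i)).toReal := by
    intro x hx
    rw [Finset.sum_congr rfl fun i _ => (EReal.coe_toReal (hx i) (hbot i _)).symm,
      ← coe_finset_sum, EReal.toReal_coe]
  have hcx := fun i => convexOn_sepPart hn hgam (hφ i)
  have hconv : Convex ℝ (effDom (fun x : Vec n => ∑ i, sepPart φ gam i (x i))) := by
    intro x hx y hy a b ha hb hab
    rw [hmem] at hx hy ⊢
    exact fun i => (hcx i).1 (hx i) (hy i) ha hb hab
  have hf : StrongConvexOn Set.univ (gam / n) (smoothPart g A lam gam) :=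
    strongConvexOn_univ_of_tangent fun y w =>
      ((hasGradientAt_smoothPart hn hlam hgam hg y).2 w).1
  obtain ⟨xs, hxs, hmin⟩ := exists_strong_minimizer
    (h := fun x : Vec n => ∑ i, sepPart φ gam i (x i)) (c := smoothPart g A lam gam)
    (m := gam / n) (by positivity) (fun x => sum_ne_bot fun i _ => hbot i _)
    ⟨WithLp.toLp 2 fun i => -deriv (φ i) 0, (hmem _).2 fun i => (sepPart_ne_top_iff hn).2 (by
      simpa using conjReal_deriv_ne_top (hφconv i) (hφ i).differentiable)⟩
    (lowerSemicontinuous_finset_sum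
      (fun i _ => lowerSemicontinuous_sepPart.comp (by fun_prop)) fun i _ x => hbot i _)
    (continuous_smoothPart hn hlam hgam hg)
    ⟨hconv, fun x hx y hy a b ha hb hab => by
      have h1 := hf.2 (Set.mem_univ x) (Set.mem_univ y) ha hb hab
      have h2 : ∑ i, (sepPart φ gam i ((a • x + b • y) i)).toReal
          ≤ a * ∑ i, (sepPart φ gam i (x i)).toReal
            + b * ∑ i, (sepPart φ gam i (y i)).toReal := by
        rw [Finset.mul_sum, Finset.mul_sum, ← Finset.sum_add_distrib]
        exact Finset.sum_le_sum fun i _ =>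
          (hcx i).2 ((hmem x).1 hx i) ((hmem y).1 hy i) ha hb hab
      have h3 := hconv hx hy ha hb hab
      simp only [smul_eq_mul] at h1 ⊢
      rw [hreal _ ((hmem _).1 hx), hreal _ ((hmem _).1 hy), hreal _ ((hmem _).1 h3)]
      linarith⟩
  refine ⟨xs, (hmem xs).1 hxs, fun x hx => ?_⟩
  have := hmin x ((hmem x).2 hx)
  rw [hreal _ hx, hreal _ ((hmem xs).1 hxs)] at this
  linarith

end Dual

/-! ### The proximal step -/

theorem exists_coordinate_prox {Ψ : ℝ → EReal} {K G c : ℝ} (hK : 0 < K)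
    (hbot : ∀ t, Ψ t ≠ ⊥) (hne : (effDom Ψ).Nonempty) (hlsc : LowerSemicontinuous Ψ)
    (hconv : ConvexOn ℝ (effDom Ψ) (fun t => (Ψ t).toReal)) :
    ∃ T ∈ effDom Ψ, ∀ t ∈ effDom Ψ,
      K * (T - c) ^ 2 + G * T + (Ψ T).toReal + K * (t - T) ^ 2
        ≤ K * (t - c) ^ 2 + G * t + (Ψ t).toReal := by
  obtain ⟨T, hT, hmin⟩ := exists_strong_minimizer (h := Ψ)
    (c := fun t => K * (t - c) ^ 2 + G * t) (m := 2 * K) (by positivity) hbot hne hlsc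
    (by fun_prop) ⟨hconv.1, fun s hs t ht a b ha hb hab => by
      have h1 := hconv.2 hs ht ha hb hab
      simp only [smul_eq_mul, Real.norm_eq_abs, sq_abs] at h1 ⊢
      obtain rfl : a = 1 - b := by linarith
      linarith⟩
  refine ⟨T, hT, fun t ht => ?_⟩
  have := hmin t ht
  rw [Real.norm_eq_abs, sq_abs] at this
  linarith

/-- The proximal step has a unique solution: it moves only the chosen coordinate away from
`(1 - b) z + b y`, to the solution of a strongly convex problem on the line. -/
theorem exists_prox_step {n : ℕ} {f : Vec n → ℝ} {Ψ : Fin n → ℝ → EReal} {L : Fin n → ℝ}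
    {a b : ℝ} {y z : Vec n} {i : Fin n} (hn : 0 < n) (ha : 0 < a) (hL : ∀ j, 0 < L j)
    (hbot : ∀ t, Ψ i t ≠ ⊥) (hne : (effDom (Ψ i)).Nonempty) (hlsc : LowerSemicontinuous (Ψ i))
    (hconv : ConvexOn ℝ (effDom (Ψ i)) (fun t => (Ψ i t).toReal)) :
    ∃ T ∈ effDom (Ψ i), (∀ t ∈ effDom (Ψ i),
      n * a / 2 * L i * (T - ((1 - b) * z i + b * y i)) ^ 2 + gradient f y i * T
        + (Ψ i T).toReal + n * a / 2 * L i * (t - T) ^ 2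
        ≤ n * a / 2 * L i * (t - ((1 - b) * z i + b * y i)) ^ 2 + gradient f y i * t
        + (Ψ i t).toReal) ∧
      ∀ u : Vec n, IsMinOn (stepObj f Ψ L a b y z i) Set.univ u ↔
        (∀ j, j ≠ i → u j = (1 - b) * z j + b * y j) ∧ u i = T := by
  have hn' : (0 : ℝ) < n := Nat.cast_pos.2 hn
  set K : ℝ := n * a / 2 with hKdef
  have hK : 0 < K := by positivity
  obtain ⟨T, hT, hmin⟩ := exists_coordinate_prox (G := gradient f y i)
    (c := (1 - b) * z i + b * y i) (mul_pos hK (hL i)) hbot hne hlsc hconv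
  refine ⟨T, hT, hmin, ?_⟩
  set zh : Fin n → ℝ := fun j => (1 - b) * z j + b * y j with hzh
  set q : Vec n → ℝ := fun u => K * (∑ j, L j * (u j - zh j) ^ 2) + gradient f y i * u i with hq
  have hobj : ∀ u, stepObj f Ψ L a b y z i u = (q u : EReal) + Ψ i (u i) := by
    intro u
    simp only [stepObj, hq, hzh, hKdef, sub_sub]
  have hobj' : ∀ u : Vec n, u i ∈ effDom (Ψ i) →
      stepObj f Ψ L a b y z i u = ((q u + (Ψ i (u i)).toReal : ℝ) : EReal) := by
    intro u hu
    rw [hobj, EReal.coe_add (q u), EReal.coe_toReal hu (hbot _)]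
  have hsplit : ∀ u : Vec n, q u = K * L i * (u i - zh i) ^ 2 + gradient f y i * u i
      + K * ∑ j ∈ Finset.univ.erase i, L j * (u j - zh j) ^ 2 := by
    intro u
    simp only [hq]
    rw [← Finset.add_sum_erase _ _ (Finset.mem_univ i)]
    ring
  have hrest : ∀ u : Vec n, 0 ≤ ∑ j ∈ Finset.univ.erase i, L j * (u j - zh j) ^ 2 := fun u =>
    Finset.sum_nonneg fun j _ => mul_nonneg (hL j).le (sq_nonneg _)
  have hsol : ∀ u : Vec n, (∀ j, j ≠ i → u j = zh j) → u i = T →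
      q u = K * L i * (T - zh i) ^ 2 + gradient f y i * T := by
    intro u hu huT
    rw [hsplit, huT, Finset.sum_eq_zero, mul_zero, add_zero]
    intro j hj
    rw [hu j (Finset.ne_of_mem_erase hj)]
    ring
  intro u
  constructor
  · intro hu
    -- `v` is the explicit solution. Comparing `u` with it makes both nonnegative excess terms, on
    -- coordinate `i` and on the others, vanish.
    set v : Vec n := WithLp.toLp 2 (Function.update zh i T) with hv
    have hvi : v i = T := by simp [hv]
    have hvj : ∀ j, j ≠ i → v j = zh j := fun j hj => by simp [hv, hj]
    have h1 : stepObj f Ψ L a b y z i u ≤ stepObj f Ψ L a b y z i v := hu (Set.mem_univ v)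
    rw [hobj' v (hvi ▸ hT), hsol v hvj hvi, hvi] at h1
    have hui : u i ∈ effDom (Ψ i) := by
      intro htop
      rw [hobj, htop, EReal.coe_add_top, top_le_iff] at h1
      exact EReal.coe_ne_top _ h1
    rw [hobj' u hui, EReal.coe_le_coe_iff, hsplit] at h1
    have h2 := hmin (u i) hui
    have h3 : 0 ≤ K * L i * (u i - T) ^ 2 :=
      mul_nonneg (mul_pos hK (hL i)).le (sq_nonneg _)
    have h4 := mul_nonneg hK.le (hrest u)
    have h5 : K * L i * (u i - T) ^ 2 = 0 := by linarith
    have h6 : K * ∑ j ∈ Finset.univ.erase i, L j * (u j - zh j) ^ 2 = 0 := by linarith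
    refine ⟨fun j hj => ?_, ?_⟩
    · have h7 := (mul_eq_zero.1 h6).resolve_left hK.ne'
      rw [Finset.sum_eq_zero_iff_of_nonneg fun j _ => mul_nonneg (hL j).le (sq_nonneg _)] at h7
      have h8 := (mul_eq_zero.1 (h7 j (Finset.mem_erase.2 ⟨hj, Finset.mem_univ j⟩))).resolve_left
        (hL j).ne'
      exact sub_eq_zero.1 (pow_eq_zero_iff two_ne_zero |>.1 h8)
    · have h8 := (mul_eq_zero.1 h5).resolve_left (mul_pos hK (hL i)).ne'
      exact sub_eq_zero.1 (pow_eq_zero_iff two_ne_zero |>.1 h8)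
  · rintro ⟨huj, hui⟩ v -
    change stepObj f Ψ L a b y z i u ≤ stepObj f Ψ L a b y z i v
    by_cases hvi : v i ∈ effDom (Ψ i)
    · rw [hobj' u (hui ▸ hT), hobj' v hvi, EReal.coe_le_coe_iff, hsol u huj hui, hui, hsplit v]
      have h2 := hmin (v i) hvi
      have h3 : 0 ≤ K * L i * (v i - T) ^ 2 :=
        mul_nonneg (mul_pos hK (hL i)).le (sq_nonneg _)
      have h4 := mul_nonneg hK.le (hrest v)
      linarith
    · have htop : Ψ i (v i) = ⊤ := by simpa [effDom] using hvi
      rw [hobj v, htop, EReal.coe_add_top]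
      exact le_top

/-! ### The scalar sequences -/

section Params

variable {n : ℕ} {μ gam0 : ℝ} {α γ : ℕ → ℝ}

theorem IsParams.gamma_succ_eq (h : IsParams n μ gam0 α γ) (k : ℕ) :
    γ (k + 1) = (n * α k) ^ 2 := by
  rw [h.gamma_succ, ← h.alpha_eq, mul_pow]

theorem IsParams.natCast_mul_alpha_le (h : IsParams n μ gam0 α γ) (hn : 0 < n) (k : ℕ) :
    n * α k ≤ 1 := by
  have hn' : (0 : ℝ) < n := Nat.cast_pos.2 hn
  have := h.alpha_le k
  rw [le_div_iff₀ hn'] at this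
  linarith

theorem IsParams.alpha_le_one (h : IsParams n μ gam0 α γ) (hn : 0 < n) (k : ℕ) : α k ≤ 1 := by
  have h1 : (1 : ℝ) ≤ n := Nat.one_le_cast.2 hn
  nlinarith [h.natCast_mul_alpha_le hn k, h.alpha_pos k]

theorem IsParams.gamma_bounds (h : IsParams n μ gam0 α γ) (hn : 0 < n) (hμ : μ ≤ gam0)
    (h0 : gam0 ≤ 1) (k : ℕ) : μ ≤ γ k ∧ γ k ≤ 1 := by
  induction k with
  | zero => exact h.gamma_zero ▸ ⟨hμ, h0⟩
  | succ k ih =>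
    rw [h.gamma_succ]
    have h1 := h.alpha_pos k
    have h2 := h.alpha_le_one hn k
    constructor <;> nlinarith

theorem IsParams.sqrt_div_le_alpha (h : IsParams n μ gam0 α γ) (hn : 0 < n) (hμ : μ ≤ gam0)
    (h0 : gam0 ≤ 1) (k : ℕ) : √μ / n ≤ α k := by
  have hn' : (0 : ℝ) < n := Nat.cast_pos.2 hn
  rw [div_le_iff₀ hn', mul_comm]
  refine Real.sqrt_le_iff.2 ⟨(mul_pos hn' (h.alpha_pos k)).le, ?_⟩
  rw [← h.gamma_succ_eq]
  exact (h.gamma_bounds hn hμ h0 (k + 1)).1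

/-- Intermediate values on `[0, 1/n]`: the difference of the two sides is `-c < 0` at `0`, and
nonnegative at `1/n` because `c` and `μ` are at most one. -/
theorem exists_alpha (hn : 0 < n) (hμ : 0 < μ) {c : ℝ} (hc : μ ≤ c) (hc1 : c ≤ 1) :
    ∃ a : ℝ, 0 < a ∧ a ≤ 1 / (n : ℝ) ∧ (n : ℝ) ^ 2 * a ^ 2 = (1 - a) * c + a * μ := by
  have hn' : (0 : ℝ) < n := Nat.cast_pos.2 hn
  have hn1 : 1 / (n : ℝ) ≤ 1 := by
    rw [div_le_one hn']
    exact Nat.one_le_cast.2 hn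
  obtain ⟨a, ⟨ha0, ha1⟩, ha⟩ := intermediate_value_Icc (a := 0) (b := 1 / (n : ℝ))
    (f := fun a => (n : ℝ) ^ 2 * a ^ 2 - ((1 - a) * c + a * μ)) (by positivity)
    (by fun_prop) (show (0 : ℝ) ∈ _ by
      have h1 : (n : ℝ) ^ 2 * (1 / n) ^ 2 = 1 := by field_simp
      have h2 : 0 < 1 / (n : ℝ) := by positivity
      constructor
      · nlinarith
      · rw [h1]; nlinarith)
  simp only at ha
  refine ⟨a, lt_of_le_of_ne ha0 ?_, ha1, by linarith⟩
  rintro rfl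
  norm_num at ha
  linarith

theorem exists_isParams (hn : 0 < n) (hμ : 0 < μ) (hμ0 : μ ≤ gam0) (h0 : gam0 ≤ 1) :
    ∃ α γ : ℕ → ℝ, IsParams n μ gam0 α γ := by
  choose a ha0 ha1 ha using fun c : {c : ℝ // μ ≤ c ∧ c ≤ 1} =>
    exists_alpha hn hμ c.2.1 c.2.2
  have hle : ∀ c, a c ≤ 1 := fun c => (ha1 c).trans (by
    rw [div_le_one (Nat.cast_pos.2 hn)]
    exact Nat.one_le_cast.2 hn)
  let next : {c : ℝ // μ ≤ c ∧ c ≤ 1} → {c : ℝ // μ ≤ c ∧ c ≤ 1} := fun c =>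
    ⟨(1 - a c) * c + a c * μ, by nlinarith [c.2.1, hle c, ha0 c],
      by nlinarith [c.2.1, c.2.2, hle c, ha0 c]⟩
  let G : ℕ → {c : ℝ // μ ≤ c ∧ c ≤ 1} := fun k => next^[k] ⟨gam0, hμ0, h0⟩
  refine ⟨fun k => a (G k), fun k => G k, rfl, fun k => ha0 _, fun k => ha1 _, fun k => ha _,
    fun k => ?_⟩
  simp only [G, Function.iterate_succ_apply', next]

/-- The weight of `z_k` in the representation of `x_k` stays nonnegative after a step. -/
theorem weight_nonneg {N μ s t : ℝ} (hs : 0 < s) (ht : 0 < t)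
    (hμ : 0 ≤ μ) (hμ1 : μ ≤ 1) (ht1 : t ≤ 1) (h : N * t ^ 2 = (N - t) * s ^ 2 + t * μ) :
    (N - 1) * s ≤ (N - μ) * t := by
  -- The factor `s + t` lets the quadratic relation `h` rewrite the difference as a sum of
  -- nonnegative terms.
  have h1 : (s + t) * ((N - 1) * s) ≤ (s + t) * ((N - μ) * t) := by
    have e : (s + t) * ((N - μ) * t) - (s + t) * ((N - 1) * s)
        = s ^ 2 * (1 - t) + s * t * (1 - μ) + μ * t * (1 - t) := by linear_combination h
    have p1 : 0 ≤ s ^ 2 * (1 - t) := mul_nonneg (sq_nonneg _) (by linarith)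
    have p2 : 0 ≤ s * t * (1 - μ) := mul_nonneg (by positivity) (by linarith)
    have p3 : 0 ≤ μ * t * (1 - t) := mul_nonneg (by positivity) (by linarith)
    linarith
  exact le_of_mul_le_mul_left h1 (by positivity)

end Params

/-! ### Mixtures -/

/-- `x` is a mixture of `z`, with weight `θ`, and of a point of `S`, and `p` bounds the
corresponding mixture of values of `Ψ`. -/
def IsMixture {E : Type*} [AddCommGroup E] [Module ℝ E] (S : Set E) (Ψ : E → ℝ) (θ : ℝ)
    (x z : E) (p : ℝ) : Prop :=
  ∃ r ∈ S, x = (1 - θ) • r + θ • z ∧ (1 - θ) * Ψ r + θ * Ψ z ≤ p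

section Mixture

variable {E : Type*} [AddCommGroup E] [Module ℝ E] {S : Set E} {Ψ : E → ℝ} {θ : ℝ} {x z : E}
  {p : ℝ}

theorem IsMixture.mem (h : IsMixture S Ψ θ x z p) (hS : Convex ℝ S) (hz : z ∈ S) (h0 : 0 ≤ θ)
    (h1 : θ ≤ 1) : x ∈ S := by
  obtain ⟨r, hr, rfl, -⟩ := h
  exact hS hr hz (sub_nonneg.2 h1) h0 (by ring)

theorem IsMixture.le (h : IsMixture S Ψ θ x z p) (hΨ : ConvexOn ℝ S Ψ) (hz : z ∈ S) (h0 : 0 ≤ θ)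
    (h1 : θ ≤ 1) : Ψ x ≤ p := by
  obtain ⟨r, hr, rfl, hp⟩ := h
  exact (hΨ.2 hr hz (sub_nonneg.2 h1) h0 (by ring)).trans hp

/-- The weight `b` may be negative. Once `x` is expanded, `z` carries the total weight `b + a θ`,
and only that has to be nonnegative. -/
theorem IsMixture.step (h : IsMixture S Ψ θ x z p) (hΨ : ConvexOn ℝ S Ψ) (hz : z ∈ S)
    (h1 : θ ≤ 1) {a b θ' : ℝ} (z' : E) (ha : 0 ≤ a) (hb : 0 ≤ b + a * θ)
    (hab : a + b + θ' = 1) :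
    IsMixture S Ψ θ' (a • x + b • z + θ' • z') z' (a * p + b * Ψ z + θ' * Ψ z') := by
  obtain ⟨r, hr, rfl, hp⟩ := h
  have ha' : 0 ≤ a * (1 - θ) := mul_nonneg ha (sub_nonneg.2 h1)
  have hap := mul_le_mul_of_nonneg_left hp ha
  -- If `θ' = 1`, the weights of `r` and `z` are nonnegative with sum zero, so `r` can be kept as a
  -- dummy. Otherwise both are renormalized by `1 - θ'`.
  rcases eq_or_ne θ' 1 with rfl | hθ'
  · have e1 : a * (1 - θ) = 0 := by nlinarith
    have e2 : b + a * θ = 0 := by nlinarith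
    refine ⟨r, hr, ?_, ?_⟩
    · have : a • ((1 - θ) • r + θ • z) + b • z = (a * (1 - θ)) • r + (b + a * θ) • z := by module
      rw [this, e1, e2]
      simp
    · have : a * ((1 - θ) * Ψ r + θ * Ψ z) + b * Ψ z
          = (a * (1 - θ)) * Ψ r + (b + a * θ) * Ψ z := by ring
      rw [e1, e2] at this
      linarith
  · have hs : a * (1 - θ) + (b + a * θ) = 1 - θ' := by linarith
    have hpos : 0 < 1 - θ' := lt_of_le_of_ne (by linarith) (sub_ne_zero.2 hθ'.symm).symm
    have w0 : 0 ≤ a * (1 - θ) / (1 - θ') := div_nonneg ha' hpos.le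
    have w1 : 0 ≤ (b + a * θ) / (1 - θ') := div_nonneg hb hpos.le
    have w2 : a * (1 - θ) / (1 - θ') + (b + a * θ) / (1 - θ') = 1 := by
      rw [← add_div, hs, div_self hpos.ne']
    refine ⟨_, hΨ.1 hr hz w0 w1 w2, ?_, ?_⟩
    · rw [smul_add (1 - θ'), smul_smul (1 - θ'), smul_smul (1 - θ'), mul_div_cancel₀ _ hpos.ne',
        mul_div_cancel₀ _ hpos.ne']
      module
    · have := mul_le_mul_of_nonneg_left (hΨ.2 hr hz w0 w1 w2) hpos.le
      rw [smul_eq_mul, smul_eq_mul, mul_add, ← mul_assoc, ← mul_assoc,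
        mul_div_cancel₀ _ hpos.ne', mul_div_cancel₀ _ hpos.ne'] at this
      linarith

end Mixture

/-! ### Expectations along uniformly sampled indices -/

section Sampling

variable {n : ℕ} {σ : Type*}

/-- The states visited from `s₀` when the `k`-th transition is `next k`, driven by `idx k`. -/
def iterState (next : ℕ → σ → Fin n → σ) (s₀ : σ) (idx : ℕ → Fin n) : ℕ → σ
  | 0 => s₀
  | k + 1 => next k (iterState next s₀ idx k) (idx k)

/-- The state reached after reading a finite word. -/
def wordState (next : ℕ → σ → Fin n → σ) (s₀ : σ) : (k : ℕ) → (Fin k → Fin n) → σ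
  | 0, _ => s₀
  | k + 1, w => next k (wordState next s₀ k (Fin.init w)) (w (Fin.last k))

/-- The state at time `k` depends only on the first `k` letters, which range over a finite set. No
measurable structure on the states is needed, and integrability is automatic. -/
theorem iterState_eq_wordState (next : ℕ → σ → Fin n → σ) (s₀ : σ) (idx : ℕ → Fin n) (k : ℕ) :
    iterState next s₀ idx k = wordState next s₀ k (fun l => idx l) := by
  induction k with
  | zero => rfl
  | succ k ih =>
    rw [iterState, wordState, ih]
    rfl

variable {Ω : Type*} [MeasurableSpace Ω] {P : Measure Ω} {idx : ℕ → Ω → Fin n}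

theorem IsUniformSampling.measurable_word (h : IsUniformSampling P idx) (k : ℕ) :
    Measurable (fun ω (l : Fin k) => idx l ω) :=
  measurable_pi_iff.2 fun l => h.measurable l

variable [IsProbabilityMeasure P]

theorem IsUniformSampling.integrable_word (h : IsUniformSampling P idx) (k : ℕ)
    (F : (Fin k → Fin n) → ℝ) : Integrable (fun ω => F (fun l => idx l ω)) P := by
  have := Measure.isProbabilityMeasure_map (μ := P) (h.measurable_word k).aemeasurable
  exact (Integrable.of_finite (μ := P.map fun ω (l : Fin k) => idx l ω)
    (f := F)).comp_measurable (h.measurable_word k)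

theorem IsUniformSampling.integral_word (h : IsUniformSampling P idx) (k : ℕ)
    (F : (Fin k → Fin n) → ℝ) :
    ∫ ω, F (fun l => idx l ω) ∂P = ((n : ℝ)⁻¹) ^ k * ∑ w, F w := by
  have := Measure.isProbabilityMeasure_map (μ := P) (h.measurable_word k).aemeasurable
  have hmap : P.map (fun ω (l : Fin k) => idx l ω)
      = Measure.pi fun l : Fin k => P.map (idx l) := by
    have h1 : iIndepFun (fun l : Fin k => idx l) P := h.indep.precomp Fin.val_injective
    exact (iIndepFun_iff_map_fun_eq_pi_map fun l => (h.measurable _).aemeasurable).1 h1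
  have h2 : ∫ w, F w ∂(P.map fun ω (l : Fin k) => idx l ω)
      = ∫ ω, F (fun l => idx l ω) ∂P :=
    integral_map (h.measurable_word k).aemeasurable
      (Measurable.of_discrete (f := F)).aestronglyMeasurable
  rw [← h2, integral_fintype (Integrable.of_finite), Finset.mul_sum]
  refine Finset.sum_congr rfl fun w _ => ?_
  have h3 : ∀ l : Fin k, (P.map (idx l)) {w l} = (n : ENNReal)⁻¹ := by
    intro l
    rw [Measure.map_apply (h.measurable _) (measurableSet_singleton _)]
    exact h.uniform l (w l)
  have := fun l : Fin k => Measure.isProbabilityMeasure_map (μ := P) (h.measurable l).aemeasurable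
  rw [smul_eq_mul, Measure.real, hmap, Measure.pi_singleton]
  simp [h3]

theorem IsUniformSampling.integrable_iterState (h : IsUniformSampling P idx)
    (next : ℕ → σ → Fin n → σ) (s₀ : σ) (k : ℕ) (W : σ → ℝ) :
    Integrable (fun ω => W (iterState next s₀ (fun l => idx l ω) k)) P := by
  simp only [iterState_eq_wordState]
  exact h.integrable_word k fun w => W (wordState next s₀ k w)

theorem IsUniformSampling.integral_iterState_succ (h : IsUniformSampling P idx)
    (next : ℕ → σ → Fin n → σ) (s₀ : σ) (k : ℕ) (W : σ → ℝ) :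
    ∫ ω, W (iterState next s₀ (fun l => idx l ω) (k + 1)) ∂P
      = ∫ ω, (n : ℝ)⁻¹ * ∑ i, W (next k (iterState next s₀ (fun l => idx l ω) k) i) ∂P := by
  simp only [iterState_eq_wordState]
  rw [h.integral_word (k + 1) fun w => W (wordState next s₀ (k + 1) w),
    h.integral_word k fun w => (n : ℝ)⁻¹ * ∑ i, W (next k (wordState next s₀ k w) i),
    ← Finset.mul_sum, ← mul_assoc, ← pow_succ]
  congr 1
  -- A word of length `k + 1` is a word of length `k` and a last letter; this plays the role of
  -- conditioning on the past.
  rw [← Fintype.sum_equiv (Fin.snocEquiv fun _ : Fin (k + 1) => Fin n) _ _ fun _ => rfl,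
    Fintype.sum_prod_type, Finset.sum_comm]
  refine Finset.sum_congr rfl fun w _ => Finset.sum_congr rfl fun i _ => ?_
  simp [wordState, Fin.snocEquiv]

/-- A potential that contracts on average at every state satisfying an invariant contracts in
expectation. -/
theorem IsUniformSampling.integral_le_prod (h : IsUniformSampling P idx)
    {next : ℕ → σ → Fin n → σ} {s₀ : σ} {Inv : ℕ → σ → Prop} {W : ℕ → σ → ℝ} {c : ℕ → ℝ}
    (h0 : Inv 0 s₀) (hInv : ∀ k s i, Inv k s → Inv (k + 1) (next k s i))
    (hc : ∀ k, 0 ≤ c k)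
    (hW : ∀ k s, Inv k s → (n : ℝ)⁻¹ * ∑ i, W (k + 1) (next k s i) ≤ c k * W k s) (k : ℕ) :
    ∫ ω, W k (iterState next s₀ (fun l => idx l ω) k) ∂P
      ≤ (∏ l ∈ Finset.range k, c l) * W 0 s₀ := by
  have hI : ∀ k ω, Inv k (iterState next s₀ (fun l => idx l ω) k) := by
    intro k ω
    induction k with
    | zero => exact h0
    | succ k ih => exact hInv k _ _ ih
  induction k with
  | zero => simp [iterState]
  | succ k ih =>
    rw [h.integral_iterState_succ next s₀ k (W (k + 1)), Finset.prod_range_succ]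
    calc _ ≤ ∫ ω, c k * W k (iterState next s₀ (fun l => idx l ω) k) ∂P := by
          refine integral_mono
            (h.integrable_iterState next s₀ k fun s => (n : ℝ)⁻¹ * ∑ i, W (k + 1) (next k s i))
            ((h.integrable_iterState next s₀ k (W k)).const_mul _) fun ω => hW k _ (hI k ω)
      _ = c k * ∫ ω, W k (iterState next s₀ (fun l => idx l ω) k) ∂P :=
          integral_const_mul _ _
      _ ≤ c k * ((∏ l ∈ Finset.range k, c l) * W 0 s₀) := mul_le_mul_of_nonneg_left ih (hc k)
      _ = _ := by ring

end Sampling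

/-! ### Decrease of the potential in one step -/

section Lyapunov

variable {n : ℕ} {a c c' μ : ℝ}

/-- The weight of `x` in the representation of the next `x` by `x`, `z` and the next `z`. -/
noncomputable def weightX (n : ℕ) (μ a c c' : ℝ) : ℝ := (c' - n * a ^ 2 * μ) / (a * c + c')

/-- The weight of `z` in the representation of the next `x` by `x`, `z` and the next `z`. -/
noncomputable def weightZ (n : ℕ) (a c c' : ℝ) : ℝ := -((n - 1) * a * c) / (a * c + c')

theorem weightX_add_weightZ (ha : 0 < a) (hc : 0 < c) (hc' : 0 < c')
    (h : c' = (1 - a) * c + a * μ) : weightX n μ a c c' + weightZ n a c c' + n * a = 1 := by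
  unfold weightX weightZ
  have : a * c + c' ≠ 0 := by positivity
  field_simp
  linear_combination n * a * h

/-- The weights sum to one because `c + a μ = a c + c'`, so the centre is a convex combination of
`z` and `x` and stays in the domain. -/
theorem prox_center_eq (ha : 0 < a) (hc : 0 < c) (hc' : 0 < c')
    (h : c' = (1 - a) * c + a * μ) {x y z : ℝ} (hy : y = (a * c * z + c' * x) / (a * c + c')) :
    (1 - a * μ / c') * z + a * μ / c' * y
      = c / (a * c + c') * z + a * μ / (a * c + c') * x := by
  have hD : a * c + c' ≠ 0 := by positivity
  rw [hy]
  field_simp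
  linear_combination c' * z * h

theorem sub_prox_center_eq (ha : 0 < a) (hc : 0 < c) (hc' : 0 < c')
    (h : c' = (1 - a) * c + a * μ) {x y z : ℝ} (hy : y = (a * c * z + c' * x) / (a * c + c')) :
    y - a * ((1 - a * μ / c') * z + a * μ / c' * y) = (1 - a) * x := by
  rw [prox_center_eq ha hc hc' h hy, hy]
  have hD : a * c + c' ≠ 0 := by positivity
  field_simp
  linear_combination a * x * h

/-- The correction `(μ/n)(z - y)` exactly replaces `z` by the prox centre, so `x` differs from `y`
only in the chosen coordinate. -/
theorem next_x_eq (hn : 0 < n) (ha : 0 < a) (h : c' = (n * a) ^ 2) (y z z' : ℝ) :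
    y + n * a * (z' - z) + μ / n * (z - y)
      = y + n * a * (z' - ((1 - a * μ / c') * z + a * μ / c' * y)) := by
  have hn' : (n : ℝ) ≠ 0 := Nat.cast_ne_zero.2 hn.ne'
  rw [h]
  field_simp
  ring

theorem next_x_eq_mixture (hn : 0 < n) (ha : 0 < a) (hc : 0 < c) (hc' : 0 < c')
    (hsq : c' = (n * a) ^ 2) (h : c' = (1 - a) * c + a * μ) {x y z : ℝ} (z' : ℝ)
    (hy : y = (a * c * z + c' * x) / (a * c + c')) :
    y + n * a * (z' - z) + μ / n * (z - y)
      = weightX n μ a c c' * x + weightZ n a c c' * z + n * a * z' := by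
  rw [next_x_eq hn ha hsq, prox_center_eq ha hc hc' h hy, hy]
  unfold weightX weightZ
  have hD : a * c + c' ≠ 0 := by positivity
  field_simp
  ring

variable {f : Vec n → ℝ} {G L : Fin n → ℝ} {S : Fin n → Set ℝ} {ψ : Fin n → ℝ → ℝ}
  {x y z xs : Vec n} {xn zn : Fin n → Vec n} {p : ℝ}

/-- Decrease of the potential along one coordinate. -/
theorem coordinate_decrease (ha : 0 < a) (hn : 0 < n) {zh : Fin n → ℝ} {i : Fin n} {x' z' : Vec n}
    (hz' : ∀ j, j ≠ i → z' j = zh j) (hx' : ∀ j, x' j = y j + n * a * (z' j - zh j))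
    (hsm : ∀ w : Vec n, (∀ j, j ≠ i → w j = y j) →
      f w ≤ f y + G i * (w i - y i) + L i / 2 * (w i - y i) ^ 2)
    (hprox : n * a / 2 * L i * (z' i - zh i) ^ 2 + G i * z' i + ψ i (z' i)
        + n * a / 2 * L i * (xs i - z' i) ^ 2
      ≤ n * a / 2 * L i * (xs i - zh i) ^ 2 + G i * xs i + ψ i (xs i)) :
    f x' + n * a * ∑ j, ψ j (z' j) + (n * a) ^ 2 / 2 * ∑ j, L j * (z' j - xs j) ^ 2
      ≤ f y + n * a * ∑ j, ψ j (zh j) + (n * a) ^ 2 / 2 * ∑ j, L j * (zh j - xs j) ^ 2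
        + n * a * (G i * (xs i - zh i) + ψ i (xs i) - ψ i (zh i)) := by
  have hn' : (0 : ℝ) < n := Nat.cast_pos.2 hn
  -- As `x' - y = n a (z' - zh)`, the smoothness term is `(n a)²/2 * L i (z' i - zh i)²`. It cancels
  -- against the proximal inequality multiplied by `n a`.
  have h1 := hsm x' fun j hj => by rw [hx' j, hz' j hj]; ring
  have h2 := mul_le_mul_of_nonneg_left hprox (mul_pos hn' ha).le
  have e1 : ∑ j, ψ j (z' j) = ∑ j, ψ j (zh j) + (ψ i (z' i) - ψ i (zh i)) := by
    rw [← Finset.add_sum_erase _ _ (Finset.mem_univ i),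
      ← Finset.add_sum_erase _ (fun j => ψ j (zh j)) (Finset.mem_univ i),
      Finset.sum_congr rfl fun j hj => by rw [hz' j (Finset.ne_of_mem_erase hj)]]
    ring
  have e2 : ∑ j, L j * (z' j - xs j) ^ 2 = ∑ j, L j * (zh j - xs j) ^ 2
      + (L i * (z' i - xs i) ^ 2 - L i * (zh i - xs i) ^ 2) := by
    rw [← Finset.add_sum_erase _ _ (Finset.mem_univ i),
      ← Finset.add_sum_erase _ (fun j => L j * (zh j - xs j) ^ 2) (Finset.mem_univ i),
      Finset.sum_congr rfl fun j hj => by rw [hz' j (Finset.ne_of_mem_erase hj)]]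
    ring
  rw [hx' i] at h1
  rw [e1, e2]
  linarith

/-- The coordinate estimates are averaged over `i`, which turns the factor `n a` into `a`. The
separable values, the distances and the smooth part are then bounded separately in `h6`, `h9` and
`h12`. -/
theorem lyapunov_decrease (hn : 0 < n) (ha : 0 < a) (ha1 : a ≤ 1) (hμ : 0 < μ) (hc : 0 < c)
    (hc' : 0 < c') (hsq : c' = (n * a) ^ 2) (h : c' = (1 - a) * c + a * μ)
    (hL : ∀ j, 0 ≤ L j) (hψ : ∀ j, ConvexOn ℝ (S j) (ψ j))
    (hxS : ∀ j, x j ∈ S j) (hzS : ∀ j, z j ∈ S j)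
    (hy : ∀ j, y j = (a * c * z j + c' * x j) / (a * c + c'))
    (hzn : ∀ i j, j ≠ i → zn i j = (1 - a * μ / c') * z j + a * μ / c' * y j)
    (hxn : ∀ i j, xn i j = y j + n * a * (zn i j - z j) + μ / n * (z j - y j))
    (hsm : ∀ i (w : Vec n), (∀ j, j ≠ i → w j = y j) →
      f w ≤ f y + G i * (w i - y i) + L i / 2 * (w i - y i) ^ 2)
    (htan : ∀ w : Vec n, f y + ∑ j, G j * (w j - y j) + μ / 2 * ∑ j, L j * (w j - y j) ^ 2 ≤ f w)
    (hprox : ∀ i, n * a / 2 * L i * (zn i i - ((1 - a * μ / c') * z i + a * μ / c' * y i)) ^ 2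
        + G i * zn i i + ψ i (zn i i) + n * a / 2 * L i * (xs i - zn i i) ^ 2
      ≤ n * a / 2 * L i * (xs i - ((1 - a * μ / c') * z i + a * μ / c' * y i)) ^ 2
        + G i * xs i + ψ i (xs i))
    (hp : ∑ j, ψ j (x j) ≤ p) :
    (n : ℝ)⁻¹ * ∑ i, (f (xn i) + (weightX n μ a c c' * p + weightZ n a c c' * ∑ j, ψ j (z j)
        + n * a * ∑ j, ψ j (zn i j)) - (f xs + ∑ j, ψ j (xs j))
        + c' / 2 * ∑ j, L j * (zn i j - xs j) ^ 2)
      ≤ (1 - a) * (f x + p - (f xs + ∑ j, ψ j (xs j)) + c / 2 * ∑ j, L j * (z j - xs j) ^ 2) := by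
  have hn' : (0 : ℝ) < n := Nat.cast_pos.2 hn
  have hn1 : (1 : ℝ) ≤ n := Nat.one_le_cast.2 hn
  have hD : 0 < a * c + c' := by positivity
  set zh : Fin n → ℝ := fun j => (1 - a * μ / c') * z j + a * μ / c' * y j with hzh
  set κ : ℝ := weightX n μ a c c' * p + weightZ n a c c' * ∑ j, ψ j (z j) with hκ
  set F : ℝ := f xs + ∑ j, ψ j (xs j) with hF
  have h1 : ∀ i, f (xn i) + (κ + n * a * ∑ j, ψ j (zn i j)) - F
        + c' / 2 * ∑ j, L j * (zn i j - xs j) ^ 2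
      ≤ (f y + κ - F + n * a * ∑ j, ψ j (zh j) + c' / 2 * ∑ j, L j * (zh j - xs j) ^ 2)
        + n * a * (G i * (xs i - zh i) + ψ i (xs i) - ψ i (zh i)) := by
    intro i
    have := coordinate_decrease (x' := xn i) (zh := zh) ha hn (hzn i)
      (fun j => by rw [hxn i j, next_x_eq hn ha hsq]) (hsm i) (hprox i)
    rw [hsq]
    linarith
  have h2 := mul_le_mul_of_nonneg_left (Finset.sum_le_sum fun i (_ : i ∈ Finset.univ) => h1 i)
    (inv_nonneg.2 hn'.le)
  have e1 : (n : ℝ)⁻¹ * ∑ i, ((f y + κ - F + n * a * ∑ j, ψ j (zh j)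
          + c' / 2 * ∑ j, L j * (zh j - xs j) ^ 2)
        + n * a * (G i * (xs i - zh i) + ψ i (xs i) - ψ i (zh i)))
      = f y + κ - F + n * a * ∑ j, ψ j (zh j) + c' / 2 * ∑ j, L j * (zh j - xs j) ^ 2
        + a * (∑ j, G j * (xs j - zh j) + ∑ j, ψ j (xs j) - ∑ j, ψ j (zh j)) := by
    rw [Finset.sum_add_distrib, Finset.sum_const, ← Finset.mul_sum, Finset.sum_sub_distrib,
      Finset.sum_add_distrib, Finset.card_univ, Fintype.card_fin, nsmul_eq_mul]
    field_simp
  refine h2.trans (e1.trans_le ?_)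
  have hb0 : 0 ≤ a * μ / c' := by positivity
  have hb1 : a * μ / c' ≤ 1 := by
    rw [div_le_one hc', h]
    nlinarith
  have h3 : ∑ j, ψ j (zh j) ≤ c / (a * c + c') * ∑ j, ψ j (z j) + a * μ / (a * c + c') * p := by
    have hw : c / (a * c + c') + a * μ / (a * c + c') = 1 := by
      rw [← add_div, div_eq_one_iff_eq hD.ne']
      linarith
    have h4 : ∑ j, ψ j (zh j) ≤ c / (a * c + c') * ∑ j, ψ j (z j)
        + a * μ / (a * c + c') * ∑ j, ψ j (x j) := by
      rw [Finset.mul_sum, Finset.mul_sum, ← Finset.sum_add_distrib]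
      refine Finset.sum_le_sum fun j _ => ?_
      rw [hzh]
      simp only
      rw [prox_center_eq ha hc hc' h (hy j)]
      exact (hψ j).2 (hzS j) (hxS j) (by positivity) (by positivity) hw
    have h5 := mul_le_mul_of_nonneg_left hp (show 0 ≤ a * μ / (a * c + c') by positivity)
    linarith
  -- Averaging leaves `(n - 1) a` times the separable value at the centre. Its convexity bound has a
  -- `z`-term that `weightZ` is built to cancel.
  have h6 : κ + (n - 1) * a * ∑ j, ψ j (zh j) ≤ (1 - a) * p := by
    have h7 := mul_le_mul_of_nonneg_left h3
      (show 0 ≤ (n - 1) * a from mul_nonneg (by linarith) ha.le)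
    have h8 : κ + (n - 1) * a * (c / (a * c + c') * ∑ j, ψ j (z j) + a * μ / (a * c + c') * p)
        = (1 - a) * p := by
      rw [hκ]
      unfold weightX weightZ
      field_simp
      linear_combination a * p * h
    linarith
  have h9 : c' / 2 * ∑ j, L j * (zh j - xs j) ^ 2
      ≤ (1 - a) * (c / 2 * ∑ j, L j * (z j - xs j) ^ 2)
        + a * (μ / 2 * ∑ j, L j * (y j - xs j) ^ 2) := by
    have h10 : ∑ j, L j * (zh j - xs j) ^ 2
        ≤ (1 - a * μ / c') * ∑ j, L j * (z j - xs j) ^ 2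
          + a * μ / c' * ∑ j, L j * (y j - xs j) ^ 2 := by
      rw [Finset.mul_sum, Finset.mul_sum, ← Finset.sum_add_distrib]
      refine Finset.sum_le_sum fun j _ => ?_
      have e : (1 - a * μ / c') * (L j * (z j - xs j) ^ 2)
          + a * μ / c' * (L j * (y j - xs j) ^ 2) - L j * (zh j - xs j) ^ 2
          = L j * (a * μ / c' * (1 - a * μ / c') * (z j - y j) ^ 2) := by
        rw [hzh]
        ring
      have : 0 ≤ L j * (a * μ / c' * (1 - a * μ / c') * (z j - y j) ^ 2) :=
        mul_nonneg (hL j) (mul_nonneg (mul_nonneg hb0 (by linarith)) (sq_nonneg _))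
      linarith
    have h11 := mul_le_mul_of_nonneg_left h10 (half_pos hc').le
    have e2 : c' / 2 * ((1 - a * μ / c') * ∑ j, L j * (z j - xs j) ^ 2
          + a * μ / c' * ∑ j, L j * (y j - xs j) ^ 2)
        = (1 - a) * (c / 2 * ∑ j, L j * (z j - xs j) ^ 2)
          + a * (μ / 2 * ∑ j, L j * (y j - xs j) ^ 2) := by
      field_simp
      linear_combination (∑ j, L j * (z j - xs j) ^ 2) * h
    linarith
  -- Since `y - a zh = (1 - a) x`, the linear term splits into tangents at `y` towards `xs` and `x`.
  -- The tangent towards `xs` pays for the `y`-distance left by `h9`.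
  have h12 : f y + a * ∑ j, G j * (xs j - zh j)
      ≤ a * (f xs - μ / 2 * ∑ j, L j * (y j - xs j) ^ 2) + (1 - a) * f x := by
    have e3 : a * ∑ j, G j * (xs j - zh j)
        = a * ∑ j, G j * (xs j - y j) + (1 - a) * ∑ j, G j * (x j - y j) := by
      rw [Finset.mul_sum, Finset.mul_sum, Finset.mul_sum, ← Finset.sum_add_distrib]
      refine Finset.sum_congr rfl fun j _ => ?_
      have := sub_prox_center_eq ha hc hc' h (hy j)
      rw [hzh]
      linear_combination G j * this
    have e4 : ∑ j, L j * (xs j - y j) ^ 2 = ∑ j, L j * (y j - xs j) ^ 2 :=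
      Finset.sum_congr rfl fun j _ => by ring
    have h13 := mul_le_mul_of_nonneg_left (htan xs) ha.le
    have h14 := mul_le_mul_of_nonneg_left (htan x) (sub_nonneg.2 ha1)
    have h15 : 0 ≤ (1 - a) * (μ / 2 * ∑ j, L j * (x j - y j) ^ 2) :=
      mul_nonneg (sub_nonneg.2 ha1) (mul_nonneg (by positivity)
        (Finset.sum_nonneg fun j _ => mul_nonneg (hL j) (sq_nonneg _)))
    rw [e4] at h13
    linarith
  linarith

end Lyapunov

/-! ### Convergence of the method for composite objectives -/

/-- The domain of a separable function. -/
def sepDom {n : ℕ} (Ψ : Fin n → ℝ → EReal) : Set (Vec n) := {x | ∀ i, x i ∈ effDom (Ψ i)}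

/-- The real value of a separable function. -/
noncomputable def sepVal {n : ℕ} (Ψ : Fin n → ℝ → EReal) (x : Vec n) : ℝ :=
  ∑ i, (Ψ i (x i)).toReal

theorem convexOn_sepVal {n : ℕ} {Ψ : Fin n → ℝ → EReal}
    (hconv : ∀ i, ConvexOn ℝ (effDom (Ψ i)) (fun t => (Ψ i t).toReal)) :
    ConvexOn ℝ (sepDom Ψ) (sepVal Ψ) := by
  refine ⟨fun x hx y hy a b ha hb hab i => (hconv i).1 (hx i) (hy i) ha hb hab,
    fun x hx y hy a b ha hb hab => ?_⟩
  unfold sepVal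
  rw [smul_eq_mul, smul_eq_mul, Finset.mul_sum, Finset.mul_sum, ← Finset.sum_add_distrib]
  exact Finset.sum_le_sum fun i _ => (hconv i).2 (hx i) (hy i) ha hb hab

/-- A composite objective `f + ∑ i, Ψ_i` to which the method applies: `f` is coordinatewise
smooth with constants `L` and has convexity parameter `μ` for the norm weighted by `L`. -/
structure IsComposite {n : ℕ} (f : Vec n → ℝ) (Ψ : Fin n → ℝ → EReal) (L : Fin n → ℝ)
    (μ : ℝ) : Prop where
  ne_bot : ∀ i t, Ψ i t ≠ ⊥
  nonempty_dom : ∀ i, (effDom (Ψ i)).Nonempty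
  lsc : ∀ i, LowerSemicontinuous (Ψ i)
  convex : ∀ i, ConvexOn ℝ (effDom (Ψ i)) (fun t => (Ψ i t).toReal)
  pos : ∀ i, 0 < L i
  smooth : ∀ (y : Vec n) i (w : Vec n), (∀ j, j ≠ i → w j = y j) →
    f w ≤ f y + gradient f y i * (w i - y i) + L i / 2 * (w i - y i) ^ 2
  tangent : ∀ y w : Vec n, f y + ∑ j, gradient f y j * (w j - y j)
    + μ / 2 * ∑ j, L j * (w j - y j) ^ 2 ≤ f w

section Method

variable {n : ℕ} (Ψ : Fin n → ℝ → EReal) (μ : ℝ) (α γ : ℕ → ℝ)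
  (T : ℕ → Vec n → Vec n → Fin n → ℝ)

/-- The extrapolated point. -/
noncomputable def nextY (k : ℕ) (x z : Vec n) : Vec n :=
  (1 / (α k * γ k + γ (k + 1))) • ((α k * γ k) • z + γ (k + 1) • x)

/-- The proximal point, where `T` solves the coordinate problems. -/
noncomputable def nextZ (k : ℕ) (y z : Vec n) (i : Fin n) : Vec n :=
  WithLp.toLp 2 (Function.update
    (fun j => (1 - α k * μ / γ (k + 1)) * z j + α k * μ / γ (k + 1) * y j) i (T k y z i))

/-- The next iterate. -/
noncomputable def nextX (k : ℕ) (y z z' : Vec n) : Vec n :=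
  y + ((n : ℝ) * α k) • (z' - z) + (μ / n) • (z - y)

/-- The transition of the method; the last component of the state `(x, z, p)` bounds the value
at `x` of the separable part. -/
noncomputable def transition (k : ℕ) (s : Vec n × Vec n × ℝ) (i : Fin n) : Vec n × Vec n × ℝ :=
  let y := nextY α γ k s.1 s.2.1
  let z' := nextZ μ α γ T k y s.2.1 i
  (nextX μ α k y s.2.1 z', z', weightX n μ (α k) (γ k) (γ (k + 1)) * s.2.2
    + weightZ n (α k) (γ k) (γ (k + 1)) * sepVal Ψ s.2.1 + n * α k * sepVal Ψ z')

/-- The invariant of the method. -/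
def Invariant (k : ℕ) (s : Vec n × Vec n × ℝ) : Prop :=
  s.2.1 ∈ sepDom Ψ ∧ IsMixture (sepDom Ψ) (sepVal Ψ) (√(γ k)) s.1 s.2.1 s.2.2

end Method

section Convergence

variable {n : ℕ} {f : Vec n → ℝ} {Ψ : Fin n → ℝ → EReal} {L : Fin n → ℝ} {μ gam0 : ℝ}
  {α γ : ℕ → ℝ} {T : ℕ → Vec n → Vec n → Fin n → ℝ} {x0 : Vec n}

theorem nextY_apply (k : ℕ) (x z : Vec n) (j : Fin n) :
    nextY α γ k x z j = (α k * γ k * z j + γ (k + 1) * x j) / (α k * γ k + γ (k + 1)) := by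
  simp [nextY, div_eq_inv_mul, mul_add]

theorem nextZ_self (k : ℕ) (y z : Vec n) (i : Fin n) : nextZ μ α γ T k y z i i = T k y z i := by
  simp [nextZ]

theorem nextZ_of_ne (k : ℕ) (y z : Vec n) {i j : Fin n} (h : j ≠ i) :
    nextZ μ α γ T k y z i j
      = (1 - α k * μ / γ (k + 1)) * z j + α k * μ / γ (k + 1) * y j := by
  simp [nextZ, h]

theorem nextX_apply (k : ℕ) (y z z' : Vec n) (j : Fin n) :
    nextX μ α k y z z' j = y j + n * α k * (z' j - z j) + μ / n * (z j - y j) := by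
  simp [nextX]

theorem isRun_iterState {idx : ℕ → Fin n}
    (hT : ∀ k y z i u, IsMinOn (stepObj f Ψ L (α k) (α k * μ / γ (k + 1)) y z i) Set.univ u ↔
      (∀ j, j ≠ i → u j = (1 - α k * μ / γ (k + 1)) * z j + α k * μ / γ (k + 1) * y j) ∧
        u i = T k y z i) :
    IsRun f Ψ L μ α γ x0 idx
      (fun k => (iterState (transition Ψ μ α γ T) (x0, x0, sepVal Ψ x0) idx k).1)
      (fun k => nextY α γ k (iterState (transition Ψ μ α γ T) (x0, x0, sepVal Ψ x0) idx k).1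
        (iterState (transition Ψ μ α γ T) (x0, x0, sepVal Ψ x0) idx k).2.1)
      (fun k => (iterState (transition Ψ μ α γ T) (x0, x0, sepVal Ψ x0) idx k).2.1) where
  x_zero := rfl
  z_zero := rfl
  y_eq _ := rfl
  z_succ _ := (hT _ _ _ _ _).2 ⟨fun _ hj => nextZ_of_ne _ _ _ hj, nextZ_self _ _ _ _⟩
  x_succ _ := rfl

/-- Uniqueness of the proximal point makes every run coincide with the deterministic recursion. -/
theorem IsRun.eq_iterState {idx : ℕ → Fin n} {x y z : ℕ → Vec n}
    (hT : ∀ k y z i u, IsMinOn (stepObj f Ψ L (α k) (α k * μ / γ (k + 1)) y z i) Set.univ u ↔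
      (∀ j, j ≠ i → u j = (1 - α k * μ / γ (k + 1)) * z j + α k * μ / γ (k + 1) * y j) ∧
        u i = T k y z i)
    (h : IsRun f Ψ L μ α γ x0 idx x y z) (k : ℕ) :
    x k = (iterState (transition Ψ μ α γ T) (x0, x0, sepVal Ψ x0) idx k).1 ∧
      z k = (iterState (transition Ψ μ α γ T) (x0, x0, sepVal Ψ x0) idx k).2.1 := by
  induction k with
  | zero => exact ⟨h.x_zero, h.z_zero⟩
  | succ k ih =>
    have hy : y k = nextY α γ k (iterState (transition Ψ μ α γ T) (x0, x0, sepVal Ψ x0) idx k).1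
        (iterState (transition Ψ μ α γ T) (x0, x0, sepVal Ψ x0) idx k).2.1 := by
      rw [h.y_eq, ← ih.1, ← ih.2]
      rfl
    obtain ⟨h1, h2⟩ := (hT _ _ _ _ _).1 (h.z_succ k)
    have hz : z (k + 1) = nextZ μ α γ T k (y k) (z k) (idx k) := by
      ext j
      rcases eq_or_ne j (idx k) with rfl | hj
      · rw [h2, nextZ_self]
      · rw [h1 j hj, nextZ_of_ne _ _ _ hj]
    have hx : x (k + 1) = nextX μ α k (y k) (z k) (z (k + 1)) := h.x_succ k
    rw [hx, hz, ih.2, hy]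
    exact ⟨rfl, rfl⟩

theorem IsParams.weightX_nonneg (h : IsParams n μ gam0 α γ) (hn : 0 < n) (hμ1 : μ ≤ 1) (k : ℕ)
    (hc : 0 < γ k) : 0 ≤ weightX n μ (α k) (γ k) (γ (k + 1)) := by
  have hn1 : (1 : ℝ) ≤ n := Nat.one_le_cast.2 hn
  have ha := h.alpha_pos k
  unfold weightX
  rw [h.gamma_succ_eq]
  refine div_nonneg ?_ (by positivity)
  have : 0 ≤ n * α k ^ 2 * (n - μ) := mul_nonneg (by positivity) (by linarith)
  linarith

theorem IsParams.weightZ_add_nonneg (h : IsParams n μ gam0 α γ) (hn : 0 < n) (hμ : 0 < μ)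
    (hμ1 : μ ≤ 1) (k : ℕ) (hc : 0 < γ k) :
    0 ≤ weightZ n (α k) (γ k) (γ (k + 1))
      + weightX n μ (α k) (γ k) (γ (k + 1)) * √(γ k) := by
  have hn' : (0 : ℝ) < n := Nat.cast_pos.2 hn
  have ha := h.alpha_pos k
  have hs := Real.sqrt_pos.2 hc
  have hss := Real.sq_sqrt hc.le
  set s := √(γ k)
  have hw := weight_nonneg (N := n) (μ := μ) (s := s) (t := n * α k) hs (by positivity) hμ.le hμ1
    (h.natCast_mul_alpha_le hn k) (by
      have h1 := h.gamma_succ k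
      rw [h.gamma_succ_eq] at h1
      rw [hss]
      linear_combination n * h1)
  have hD : 0 < α k * γ k + γ (k + 1) := by
    rw [h.gamma_succ_eq]
    positivity
  have e : weightZ n (α k) (γ k) (γ (k + 1)) + weightX n μ (α k) (γ k) (γ (k + 1)) * s
      = α k * s * ((n - μ) * (n * α k) - (n - 1) * s) / (α k * γ k + γ (k + 1)) := by
    unfold weightX weightZ
    rw [div_mul_eq_mul_div, ← add_div]
    congr 1
    rw [h.gamma_succ_eq, ← hss]
    ring
  rw [e]
  exact div_nonneg (mul_nonneg (by positivity) (sub_nonneg.2 hw)) hD.le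

/-- The potential of the method. -/
noncomputable def potential (f : Vec n → ℝ) (L : Fin n → ℝ) (γ : ℕ → ℝ) (xs : Vec n) (Fs : ℝ)
    (k : ℕ) (s : Vec n × Vec n × ℝ) : ℝ :=
  f s.1 + s.2.2 - Fs + γ k / 2 * ∑ j, L j * (s.2.1 j - xs j) ^ 2

theorem Invariant.fst_mem {k : ℕ} {s : Vec n × Vec n × ℝ} (hs : Invariant Ψ γ k s)
    (hF : IsComposite f Ψ L μ) (hn : 0 < n) (hμ0 : μ ≤ gam0) (h0 : gam0 ≤ 1)
    (hpar : IsParams n μ gam0 α γ) : s.1 ∈ sepDom Ψ :=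
  hs.2.mem (convexOn_sepVal hF.convex).1 hs.1 (Real.sqrt_nonneg _)
    (Real.sqrt_le_one.2 (hpar.gamma_bounds hn hμ0 h0 k).2)

theorem Invariant.sepVal_le {k : ℕ} {s : Vec n × Vec n × ℝ} (hs : Invariant Ψ γ k s)
    (hF : IsComposite f Ψ L μ) (hn : 0 < n) (hμ0 : μ ≤ gam0) (h0 : gam0 ≤ 1)
    (hpar : IsParams n μ gam0 α γ) : sepVal Ψ s.1 ≤ s.2.2 :=
  hs.2.le (convexOn_sepVal hF.convex) hs.1 (Real.sqrt_nonneg _)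
    (Real.sqrt_le_one.2 (hpar.gamma_bounds hn hμ0 h0 k).2)

theorem Invariant.transition {k : ℕ} {s : Vec n × Vec n × ℝ} {i : Fin n}
    (hs : Invariant Ψ γ k s) (hF : IsComposite f Ψ L μ) (hn : 0 < n) (hμ : 0 < μ)
    (hμ0 : μ ≤ gam0) (h0 : gam0 ≤ 1) (hpar : IsParams n μ gam0 α γ)
    (hTdom : ∀ k y z i, T k y z i ∈ effDom (Ψ i)) :
    Invariant Ψ γ (k + 1) (transition Ψ μ α γ T k s i) := by
  have hγb := hpar.gamma_bounds hn hμ0 h0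
  have hγ : ∀ k, 0 < γ k := fun k => hμ.trans_le (hγb k).1
  have hα := hpar.alpha_pos
  have hD : 0 < α k * γ k + γ (k + 1) := by
    have := hγ k; have := hγ (k + 1); have := hα k; positivity
  have hzdom : nextZ μ α γ T k (nextY α γ k s.1 s.2.1) s.2.1 i ∈ sepDom Ψ := by
    intro j
    rcases eq_or_ne j i with rfl | hj
    · rw [nextZ_self]
      exact hTdom _ _ _ _
    · rw [nextZ_of_ne _ _ _ hj,
        prox_center_eq (hα k) (hγ k) (hγ (k + 1)) (hpar.gamma_succ k) (nextY_apply k _ _ j)]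
      refine (hF.convex j).1 (hs.1 j) (hs.fst_mem hF hn hμ0 h0 hpar j)
        (div_nonneg (hγ k).le hD.le) (div_nonneg (mul_pos (hα k) hμ).le hD.le) ?_
      rw [← add_div, div_eq_one_iff_eq hD.ne', hpar.gamma_succ k]
      ring
  refine ⟨hzdom, ?_⟩
  -- The weight of the new `z` is `n α_k = √γ_{k+1}`, so the mixture weight in the invariant
  -- reproduces itself.
  have hsqrt : √(γ (k + 1)) = n * α k := by
    rw [hpar.gamma_succ_eq, Real.sqrt_sq (mul_nonneg n.cast_nonneg (hα k).le)]
  have hmix := hs.2.step (convexOn_sepVal hF.convex) hs.1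
      (Real.sqrt_le_one.2 (hγb k).2)
    (nextZ μ α γ T k (nextY α γ k s.1 s.2.1) s.2.1 i)
    (hpar.weightX_nonneg hn (hμ0.trans h0) k (hγ k)) (hpar.weightZ_add_nonneg hn hμ (hμ0.trans h0) k (hγ k))
    (weightX_add_weightZ (hα k) (hγ k) (hγ (k + 1)) (hpar.gamma_succ k))
  rw [hsqrt]
  have hX : (APCG.transition Ψ μ α γ T k s i).1
      = weightX n μ (α k) (γ k) (γ (k + 1)) • s.1 + weightZ n (α k) (γ k) (γ (k + 1)) • s.2.1
        + (n * α k) • nextZ μ α γ T k (nextY α γ k s.1 s.2.1) s.2.1 i := by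
    ext j
    simp only [APCG.transition]
    rw [nextX_apply, next_x_eq_mixture hn (hα k) (hγ k) (hγ (k + 1)) (hpar.gamma_succ_eq k)
      (hpar.gamma_succ k) _ (nextY_apply k _ _ j)]
    simp
  rw [hX]
  exact hmix

theorem Invariant.potential_le {k : ℕ} {s : Vec n × Vec n × ℝ}
    (hs : Invariant Ψ γ k s) (hF : IsComposite f Ψ L μ) (hn : 0 < n) (hμ : 0 < μ)
    (hμ0 : μ ≤ gam0) (h0 : gam0 ≤ 1) (hpar : IsParams n μ gam0 α γ)
    (hTprox : ∀ (y z : Vec n) (i : Fin n), ∀ t ∈ effDom (Ψ i),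
      n * α k / 2 * L i * (T k y z i
          - ((1 - α k * μ / γ (k + 1)) * z i + α k * μ / γ (k + 1) * y i)) ^ 2
        + gradient f y i * T k y z i + (Ψ i (T k y z i)).toReal
        + n * α k / 2 * L i * (t - T k y z i) ^ 2
      ≤ n * α k / 2 * L i * (t
          - ((1 - α k * μ / γ (k + 1)) * z i + α k * μ / γ (k + 1) * y i)) ^ 2
        + gradient f y i * t + (Ψ i t).toReal) {xs : Vec n} (hxs : xs ∈ sepDom Ψ) :
    (n : ℝ)⁻¹ * ∑ i, potential f L γ xs (f xs + sepVal Ψ xs) (k + 1)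
        (APCG.transition Ψ μ α γ T k s i)
      ≤ (1 - α k) * potential f L γ xs (f xs + sepVal Ψ xs) k s := by
  have hγb := hpar.gamma_bounds hn hμ0 h0
  have hγ : ∀ k, 0 < γ k := fun k => hμ.trans_le (hγb k).1
  have hα := hpar.alpha_pos
  set y := nextY α γ k s.1 s.2.1 with hy
  exact lyapunov_decrease (y := y) (G := fun i => gradient f y i)
    (ψ := fun i t => (Ψ i t).toReal)
    (xn := fun i => nextX μ α k y s.2.1 (nextZ μ α γ T k y s.2.1 i))
    (zn := fun i => nextZ μ α γ T k y s.2.1 i) hn (hα k) (hpar.alpha_le_one hn k) hμ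
    (hγ k) (hγ (k + 1)) (hpar.gamma_succ_eq k) (hpar.gamma_succ k) (fun j => (hF.pos j).le)
    hF.convex (hs.fst_mem hF hn hμ0 h0 hpar) hs.1 (nextY_apply k s.1 s.2.1)
    (fun i j hj => nextZ_of_ne _ _ _ hj) (fun i j => nextX_apply _ _ _ _ _)
    (hF.smooth y) (hF.tangent y)
    (fun i => by
      rw [nextZ_self]
      exact hTprox y s.2.1 i (xs i) (hxs i))
    (hs.sepVal_le hF hn hμ0 h0 hpar)

/-- The convergence theorem of the APCG method. -/
theorem IsComposite.convergence (hF : IsComposite f Ψ L μ) (hn : 0 < n) (hμ : 0 < μ)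
    (hμ0 : μ ≤ gam0) (h0 : gam0 ≤ 1) (hpar : IsParams n μ gam0 α γ) (hx0 : x0 ∈ sepDom Ψ) :
    (∀ idx : ℕ → Fin n, ∃ x y z : ℕ → Vec n, IsRun f Ψ L μ α γ x0 idx x y z) ∧
    ∀ (Ω : Type*) [MeasurableSpace Ω] (P : Measure Ω) [IsProbabilityMeasure P]
      (idx : ℕ → Ω → Fin n) (x y z : ℕ → Ω → Vec n), IsUniformSampling P idx →
      (∀ ω, IsRun f Ψ L μ α γ x0 (fun k => idx k ω) (fun k => x k ω) (fun k => y k ω)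
        (fun k => z k ω)) →
      ∀ k : ℕ, (∀ ω, x k ω ∈ sepDom Ψ) ∧
        ∀ xs ∈ sepDom Ψ, (∀ w ∈ sepDom Ψ, f xs + sepVal Ψ xs ≤ f w + sepVal Ψ w) →
          Integrable (fun ω => f (x k ω) + sepVal Ψ (x k ω) - (f xs + sepVal Ψ xs)) P ∧
          ∫ ω, (f (x k ω) + sepVal Ψ (x k ω) - (f xs + sepVal Ψ xs)) ∂P
            ≤ (1 - √μ / n) ^ k * (f x0 + sepVal Ψ x0 - (f xs + sepVal Ψ xs)
              + gam0 / 2 * ∑ j, L j * (x0 j - xs j) ^ 2) := by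
  have hγb := hpar.gamma_bounds hn hμ0 h0
  have hγ : ∀ k, 0 < γ k := fun k => hμ.trans_le (hγb k).1
  have hα := hpar.alpha_pos
  choose T hTdom hTprox hT using fun k (y z : Vec n) i =>
    exists_prox_step (f := f) (L := L) (a := α k) (b := α k * μ / γ (k + 1)) (y := y) (z := z)
      hn (hα k) hF.pos (hF.ne_bot i) (hF.nonempty_dom i) (hF.lsc i) (hF.convex i)
  refine ⟨fun idx => ⟨_, _, _, isRun_iterState hT⟩, ?_⟩
  have hxdom : ∀ k s, Invariant Ψ γ k s → s.1 ∈ sepDom Ψ := fun k s hs =>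
    hs.fst_mem hF hn hμ0 h0 hpar
  -- As `x0` is also the initial `z`, any mixture weight works at the start.
  have hbase : Invariant Ψ γ 0 (x0, x0, sepVal Ψ x0) :=
    ⟨hx0, x0, hx0, by simp only; module, le_of_eq (by simp only; ring)⟩
  have hinv : ∀ k s i, Invariant Ψ γ k s →
      Invariant Ψ γ (k + 1) (transition Ψ μ α γ T k s i) := fun k _ _ hs =>
    hs.transition hF hn hμ hμ0 h0 hpar hTdom
  intro Ω _ P _ idx x y z hidx hrun k
  have hxk : ∀ ω, x k ω
      = (iterState (transition Ψ μ α γ T) (x0, x0, sepVal Ψ x0) (fun l => idx l ω) k).1 :=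
    fun ω => ((hrun ω).eq_iterState hT k).1
  have hI : ∀ k ω, Invariant Ψ γ k
      (iterState (transition Ψ μ α γ T) (x0, x0, sepVal Ψ x0) (fun l => idx l ω) k) := by
    intro k ω
    induction k with
    | zero => exact hbase
    | succ k ih => exact hinv k _ _ ih
  refine ⟨fun ω => hxk ω ▸ hxdom k _ (hI k ω), fun xs hxs hmin => ?_⟩
  set Fs := f xs + sepVal Ψ xs with hFs
  simp only [hxk]
  have hint := hidx.integrable_iterState (transition Ψ μ α γ T) (x0, x0, sepVal Ψ x0) k
    fun s => f s.1 + sepVal Ψ s.1 - Fs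
  refine ⟨hint, ?_⟩
  have hW := hidx.integral_le_prod (W := potential f L γ xs Fs) (c := fun k => 1 - α k) hbase hinv
    (fun k => sub_nonneg.2 (hpar.alpha_le_one hn k)) (fun k s hs =>
      hs.potential_le hF hn hμ hμ0 h0 hpar (hTprox k) hxs) k
  have hquad : ∀ v : Vec n, 0 ≤ ∑ j, L j * (v j - xs j) ^ 2 := fun v =>
    Finset.sum_nonneg fun j _ => mul_nonneg (hF.pos j).le (sq_nonneg _)
  -- The potential dominates the gap: `p` bounds the separable part and the distance term is
  -- nonnegative.
  have hle : ∫ ω, (f (iterState (transition Ψ μ α γ T) (x0, x0, sepVal Ψ x0)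
        (fun l => idx l ω) k).1 + sepVal Ψ (iterState (transition Ψ μ α γ T)
        (x0, x0, sepVal Ψ x0) (fun l => idx l ω) k).1 - Fs) ∂P
      ≤ ∫ ω, potential f L γ xs Fs k (iterState (transition Ψ μ α γ T) (x0, x0, sepVal Ψ x0)
        (fun l => idx l ω) k) ∂P := by
    refine integral_mono hint (hidx.integrable_iterState _ _ k (potential f L γ xs Fs k)) fun ω => ?_
    have h1 := (hI k ω).sepVal_le hF hn hμ0 h0 hpar
    have h2 := mul_nonneg (half_pos (hγ k)).le (hquad (iterState (transition Ψ μ α γ T)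
      (x0, x0, sepVal Ψ x0) (fun l => idx l ω) k).2.1)
    simp only [potential]
    linarith
  have hW0 : potential f L γ xs Fs 0 (x0, x0, sepVal Ψ x0) = f x0 + sepVal Ψ x0 - Fs
      + gam0 / 2 * ∑ j, L j * (x0 j - xs j) ^ 2 := by
    simp only [potential, hpar.gamma_zero]
  have hprod : ∏ l ∈ Finset.range k, (1 - α l) ≤ (1 - √μ / n) ^ k := by
    have := Finset.prod_le_prod (s := Finset.range k)
      (fun l _ => sub_nonneg.2 (hpar.alpha_le_one hn l))
      (fun l _ => sub_le_sub_left (hpar.sqrt_div_le_alpha hn hμ0 h0 l) 1)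
    simpa using this
  rw [hW0] at hW
  refine hle.trans (hW.trans (mul_le_mul_of_nonneg_right hprod ?_))
  have h3 := hmin x0 hx0
  have h4 := mul_nonneg (half_pos (hμ.trans_le hμ0)).le (hquad x0)
  linarith

end Convergence

/-! ### Application to the dual of regularized ERM -/

theorem coordLip_ge {n d : ℕ} {A : Fin n → Vec d} {lam gam : ℝ} (hlam : 0 < lam) (i : Fin n) :
    gam / n ≤ coordLip A lam gam i := by
  have : 0 ≤ ‖A i‖ ^ 2 / (lam * (n : ℝ) ^ 2) := by positivity
  unfold coordLip
  linarith

theorem isComposite_dual {n d : ℕ} (hn : 0 < n) {φ : Fin n → ℝ → ℝ} {g : Vec d → EReal}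
    {A : Fin n → Vec d} {lam gam μ : ℝ} (hlam : 0 < lam) (hgam : 0 < gam)
    (hφconv : ∀ i, ConvexOn ℝ Set.univ (φ i)) (hφ : ∀ i, IsSmooth (1 / gam) (φ i))
    (hg : IsClosedStronglyConvex 1 g) (hμ : ∀ i, μ * coordLip A lam gam i ≤ gam / n) :
    IsComposite (smoothPart g A lam gam) (sepPart φ gam) (coordLip A lam gam) μ where
  ne_bot _ _ := sepPart_ne_bot hn
  nonempty_dom i := ⟨-deriv (φ i) 0, (sepPart_ne_top_iff hn).2 (by
    simpa using conjReal_deriv_ne_top (hφconv i) (hφ i).differentiable)⟩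
  lsc _ := lowerSemicontinuous_sepPart
  convex i := convexOn_sepPart hn hgam (hφ i)
  pos i := (div_pos hgam (Nat.cast_pos.2 hn)).trans_le (coordLip_ge hlam i)
  smooth _ _ _ hw := smoothPart_le_of_eq_off hn hlam hgam hg hw
  tangent y w := by
    have h1 := ((hasGradientAt_smoothPart (A := A) hn hlam hgam hg y).2 w).1
    rw [inner_eq_sum] at h1
    have h2 : μ / 2 * ∑ j, coordLip A lam gam j * (w j - y j) ^ 2
        ≤ gam / n / 2 * ‖w - y‖ ^ 2 := by
      rw [norm_sq_eq_sum, Finset.mul_sum, Finset.mul_sum]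
      refine Finset.sum_le_sum fun j _ => ?_
      have := mul_le_mul_of_nonneg_right (hμ j) (sq_nonneg (w j - y j))
      simp only [PiLp.sub_apply]
      linarith
    exact le_trans (add_le_add_right h2 _) h1

theorem dualObj_toReal_sub {n d : ℕ} (hn : 0 < n) {φ : Fin n → ℝ → ℝ} {g : Vec d → EReal}
    {A : Fin n → Vec d} {lam gam : ℝ} (hg : IsClosedStronglyConvex 1 g) {x y : Vec n}
    (hx : x ∈ sepDom (sepPart φ gam)) (hy : y ∈ sepDom (sepPart φ gam)) :
    (dualObj φ g A lam y).toReal - (dualObj φ g A lam x).toReal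
      = smoothPart g A lam gam x + sepVal (sepPart φ gam) x
        - (smoothPart g A lam gam y + sepVal (sepPart φ gam) y) := by
  rw [dualObj_eq_coe hn hg hx, dualObj_eq_coe hn hg hy, EReal.toReal_coe, EReal.toReal_coe]
  unfold sepVal
  ring

/-- With `q² = n R²/(lam gam)`, the lower bound on `μ` equals `n²/(n² + q²)`, and `n² + q² ≤ (n +
q)²`. -/
theorem one_le_sqrt_div_mul {n : ℕ} (hn : 0 < n) {lam gam R μ : ℝ} (hlam : 0 < lam)
    (hgam : 0 < gam) (hμ : lam * gam * n / (R ^ 2 + lam * gam * n) ≤ μ) :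
    1 ≤ √μ / n * (n + √(n * R ^ 2 / (lam * gam))) := by
  have hn' : (0 : ℝ) < n := Nat.cast_pos.2 hn
  have hpos : 0 < R ^ 2 + lam * gam * n := by positivity
  have hμ0 : 0 < μ := lt_of_lt_of_le (by positivity) hμ
  have hq : 0 ≤ n * R ^ 2 / (lam * gam) := by positivity
  set q := √(n * R ^ 2 / (lam * gam)) with hqdef
  have hq0 : 0 ≤ q := Real.sqrt_nonneg _
  have hqs : q ^ 2 = n * R ^ 2 / (lam * gam) := Real.sq_sqrt hq
  rw [div_mul_eq_mul_div, le_div_iff₀ hn', one_mul]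
  refine le_of_sq_le_sq ?_ (by positivity)
  rw [mul_pow, Real.sq_sqrt hμ0.le]
  calc (n : ℝ) ^ 2 = lam * gam * n / (R ^ 2 + lam * gam * n)
        * (n ^ 2 + n * R ^ 2 / (lam * gam)) := by field_simp; ring
    _ ≤ μ * (n + q) ^ 2 := by
        refine mul_le_mul hμ ?_ (by positivity) hμ0.le
        rw [← hqs]
        nlinarith [mul_nonneg hn'.le hq0]

theorem pow_mul_le_of_log_le {t N C ε : ℝ} {k : ℕ} (ht1 : t ≤ 1) (hN : 0 < N)
    (htN : 1 ≤ t * N) (hC : 0 ≤ C) (hε : 0 < ε) (hk : N * Real.log (C / ε) ≤ k) :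
    (1 - t) ^ k * C ≤ ε := by
  -- For `C = 0` the convention `Real.log 0 = 0` makes the condition on `k` hold always, and the
  -- conclusion is trivial.
  rcases hC.eq_or_lt with rfl | hC
  · simpa using hε.le
  have h1 : Real.log (C / ε) ≤ k * t := by
    refine le_of_mul_le_mul_left (hk.trans ?_) hN
    calc (k : ℝ) ≤ k * (t * N) := le_mul_of_one_le_right k.cast_nonneg htN
      _ = N * (k * t) := by ring
  have h2 : (1 - t) ^ k ≤ Real.exp (-(k * t)) := by
    rw [← mul_neg, Real.exp_nat_mul]
    exact pow_le_pow_left₀ (by linarith) (Real.one_sub_le_exp_neg t) k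
  have h3 : C ≤ Real.exp (k * t) * ε := by
    rw [← div_le_iff₀ hε]
    exact (Real.log_le_iff_le_exp (by positivity)).1 h1
  calc (1 - t) ^ k * C ≤ Real.exp (-(k * t)) * (Real.exp (k * t) * ε) :=
        mul_le_mul h2 h3 hC.le (Real.exp_pos _).le
    _ = ε := by rw [← mul_assoc, ← Real.exp_add]; simp

end APCG

theorem theorem2 {n d : ℕ} (hn : 0 < n)
    (φ : Fin n → ℝ → ℝ) (g : APCG.Vec d → EReal) (A : Fin n → APCG.Vec d)
    (lam gam R : ℝ) (hlam : 0 < lam) (hgam : 0 < gam)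
    (hφconv : ∀ i, ConvexOn ℝ Set.univ (φ i))
    (hφ : ∀ i, APCG.IsSmooth (1 / gam) (φ i))
    (hg : APCG.IsClosedStronglyConvex 1 g)
    (hA : ∀ i, ‖A i‖ ≤ R) :
    -- the dual problem has a unique solution `xs`, with finite optimal value
    ∃ xs : APCG.Vec n,
      APCG.dualObj φ g A lam xs ≠ ⊥ ∧ APCG.dualObj φ g A lam xs ≠ ⊤ ∧
      (∀ x, x ≠ xs → APCG.dualObj φ g A lam x < APCG.dualObj φ g A lam xs) ∧
      -- for all admissible inputs of the method
      ∀ (x0 : APCG.Vec n) (μ gam0 : ℝ), APCG.dualObj φ g A lam x0 ≠ ⊥ →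
        lam * gam * n / (R ^ 2 + lam * gam * n) ≤ μ → μ ≤ gam0 →
        (∀ i, gam0 * APCG.coordLip A lam gam i ≤ gam / n) →
        -- the method is well defined
        (∃ α γ : ℕ → ℝ, APCG.IsParams n μ gam0 α γ) ∧
        ∀ α γ : ℕ → ℝ, APCG.IsParams n μ gam0 α γ →
          (∀ idx : ℕ → Fin n, ∃ x y z : ℕ → APCG.Vec n,
            APCG.IsRun (APCG.smoothPart g A lam gam) (APCG.sepPart φ gam)
              (APCG.coordLip A lam gam) μ α γ x0 idx x y z) ∧
          -- and, with uniformly random coordinates, satisfies the complexity bound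
          ∀ (Ω : Type*) [MeasurableSpace Ω] (P : Measure Ω) [IsProbabilityMeasure P]
            (idx : ℕ → Ω → Fin n) (x y z : ℕ → Ω → APCG.Vec n),
            APCG.IsUniformSampling P idx →
            (∀ ω, APCG.IsRun (APCG.smoothPart g A lam gam) (APCG.sepPart φ gam)
              (APCG.coordLip A lam gam) μ α γ x0 (fun k => idx k ω)
              (fun k => x k ω) (fun k => y k ω) (fun k => z k ω)) →
            ∀ k : ℕ,
              (∀ ω, APCG.dualObj φ g A lam (x k ω) ≠ ⊥) ∧
              Integrable (fun ω => (APCG.dualObj φ g A lam xs).toReal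
                - (APCG.dualObj φ g A lam (x k ω)).toReal) P ∧
              ∀ ε : ℝ, 0 < ε →
                ((n : ℝ) + Real.sqrt (n * R ^ 2 / (lam * gam))) *
                  Real.log (((APCG.dualObj φ g A lam xs).toReal
                    - (APCG.dualObj φ g A lam x0).toReal
                    + gam / (2 * n) * ‖x0 - xs‖ ^ 2) / ε) ≤ (k : ℝ) →
                ∫ ω, ((APCG.dualObj φ g A lam xs).toReal
                  - (APCG.dualObj φ g A lam (x k ω)).toReal) ∂P ≤ ε := by
  have hn' : (0 : ℝ) < n := Nat.cast_pos.2 hn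
  obtain ⟨xs, hxs, hmin⟩ := APCG.exists_dual_maximizer (A := A) hn hlam hgam hφconv hφ hg
  have hD := APCG.dualObj_eq_coe (A := A) (lam := lam) hn hg hxs
  refine ⟨xs, hD ▸ EReal.coe_ne_bot _, hD ▸ EReal.coe_ne_top _, fun x hx => ?_, ?_⟩
  · by_cases hxd : ∀ i, x i ∈ APCG.effDom (APCG.sepPart φ gam i)
    · rw [hD, APCG.dualObj_eq_coe hn hg hxd, EReal.coe_lt_coe_iff]
      have h1 := hmin x hxd
      have h2 : 0 < gam / n / 2 * ‖x - xs‖ ^ 2 := by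
        have := norm_pos_iff.2 (sub_ne_zero.2 hx)
        positivity
      linarith
    · obtain ⟨i, hi⟩ := not_forall.1 hxd
      rw [hD, APCG.dualObj_eq_bot hn hi]
      exact EReal.bot_lt_coe _
  intro x0 μ gam0 hx0 hμR hμ0 hgam0
  rw [APCG.dualObj_ne_bot_iff (gam := gam) hn hg] at hx0
  have hμ : 0 < μ := lt_of_lt_of_le (by positivity) hμR
  -- `gam0 * L i ≤ gam / n ≤ L i` with `L i > 0`; the index `0` exists because `n > 0`.
  have h0 : gam0 ≤ 1 := by
    have hL := APCG.coordLip_ge (A := A) (gam := gam) hlam ⟨0, hn⟩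
    have hpos : 0 < APCG.coordLip A lam gam ⟨0, hn⟩ := (div_pos hgam hn').trans_le hL
    refine le_of_mul_le_mul_right ?_ hpos
    rw [one_mul]
    exact (hgam0 _).trans hL
  have hF : APCG.IsComposite (APCG.smoothPart g A lam gam) (APCG.sepPart φ gam)
      (APCG.coordLip A lam gam) μ :=
    APCG.isComposite_dual hn hlam hgam hφconv hφ hg fun i =>
      (mul_le_mul_of_nonneg_right hμ0 ((div_pos hgam hn').le.trans
        (APCG.coordLip_ge hlam i))).trans (hgam0 i)
  refine ⟨APCG.exists_isParams hn hμ hμ0 h0, fun α γ hpar => ?_⟩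
  obtain ⟨hexists, hconv⟩ := hF.convergence hn hμ hμ0 h0 hpar hx0
  refine ⟨hexists, fun Ω _ P _ idx x y z hidx hrun k => ?_⟩
  obtain ⟨hdom, hrate⟩ := hconv Ω P idx x y z hidx hrun k
  have hopt : ∀ w ∈ APCG.sepDom (APCG.sepPart φ gam),
      APCG.smoothPart g A lam gam xs + APCG.sepVal (APCG.sepPart φ gam) xs
        ≤ APCG.smoothPart g A lam gam w + APCG.sepVal (APCG.sepPart φ gam) w := by
    intro w hw
    have h1 := hmin w hw
    have h2 : 0 ≤ gam / n / 2 * ‖w - xs‖ ^ 2 := by positivity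
    unfold APCG.sepVal
    linarith
  obtain ⟨hint, hbound⟩ := hrate xs hxs hopt
  refine ⟨fun ω => (APCG.dualObj_ne_bot_iff hn hg).2 (hdom ω), ?_, fun ε hε hk => ?_⟩
  · simpa only [APCG.dualObj_toReal_sub hn hg (hdom _) hxs] using hint
  simp only [APCG.dualObj_toReal_sub hn hg (hdom _) hxs]
  rw [APCG.dualObj_toReal_sub hn hg hx0 hxs] at hk
  -- The condition on `gam0` replaces the weighted initial distance by the Euclidean one in `C`.
  have hquad : gam0 / 2 * ∑ j, APCG.coordLip A lam gam j * (x0 j - xs j) ^ 2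
      ≤ gam / (2 * n) * ‖x0 - xs‖ ^ 2 := by
    rw [APCG.norm_sq_eq_sum, Finset.mul_sum, Finset.mul_sum]
    refine Finset.sum_le_sum fun j _ => ?_
    have h1 := mul_le_mul_of_nonneg_right (hgam0 j) (sq_nonneg (x0 j - xs j))
    have h2 : gam / (2 * n) = gam / n / 2 := by field_simp
    rw [h2]
    simp only [PiLp.sub_apply]
    linarith
  have ht1 : √μ / n ≤ 1 := (hpar.sqrt_div_le_alpha hn hμ0 h0 0).trans (hpar.alpha_le_one hn 0)
  have hC : 0 ≤ APCG.smoothPart g A lam gam x0 + APCG.sepVal (APCG.sepPart φ gam) x0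
      - (APCG.smoothPart g A lam gam xs + APCG.sepVal (APCG.sepPart φ gam) xs)
      + gam / (2 * n) * ‖x0 - xs‖ ^ 2 :=
    add_nonneg (sub_nonneg.2 (hopt x0 hx0)) (by positivity)
  refine hbound.trans (le_trans ?_ (APCG.pow_mul_le_of_log_le ht1 (by positivity)
    (APCG.one_le_sqrt_div_mul hn hlam hgam hμR) hC hε hk))
  exact mul_le_mul_of_nonneg_left (add_le_add_right hquad _) (pow_nonneg (by linarith) k)
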